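/- Let $K$ be an infinite field, $S=K[x_1,\dots,x_n]$, and let $I\subseteq S$ be a monomial ideal with minimal system of monomial generators $G(I)$. For a monomial $u\neq 1$ let $m(u)$ be the largest index $i$ with $x_i\mid u$, and put $m(1)=0$. The ideal $I$ is called stable if $x_i(u/x_{m(u)})\in I$ for all monomials $1\neq u\in I$ and all $i<m(u)$; an ideal generated by squarefree monomials is called squarefree stable if $x_i(u/x_{m(u)})$ lies in it for all squarefree monomials $u\neq 1$ of the ideal and all $i<m(u)$ with $x_i\nmid u$. The ideal $I$ is called Borel-fixed if $g(I)=I$ for every invertible upper triangular matrix $g=(g_{ij})$ over $K$, acting on $S$ by the $K$-algebra automorphism $x_j\mapsto\sum_{i\le j}g_{ij}x_i$. For a monomial $u=x_{i_1}x_{i_2}\cdots x_{i_d}$ with $i_1\le i_2\le\cdots\le i_d$ put $u^\sigma=x_{i_1}x_{i_2+1}\cdots x_{i_d+(d-1)}$, and let $I^\sigma$ be the ideal generated by the $u^\sigma$, $u\in G(I)$, in a polynomial ring $K[x_1,\dots,x_N]$, where $N\ge 0$ is any integer with $m(u)+\deg(u)-1\le N$ for all $u\in G(I)$. If $I$ is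 stable and Borel-fixed, then $I^\sigma$ is squarefree stable with $G(I^\sigma)=\{u^\sigma : u\in G(I)\}$, and $\beta_{i,j}(I)=\beta_{i,j}(I^\sigma)$ for all $i$ and $j$. Here $\beta_{i,j}$ denotes the graded Betti numbers: for a graded ideal $J$ of a standard graded polynomial ring $R$ over $K$, $\beta_{i,j}(J)$ is the number of summands $R(-j)$ in the $i$-th module of a minimal graded free $R$-resolution of $J$. (Such resolutions of $I$ over $S$ and of $I^\sigma$ over $K[x_1,\dots,x_N]$ exist, and the numbers do not depend on their choice.) -/

import Mathlib

namespace SqfreeShift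

open MvPolynomial

noncomputable section

/-! Monomials of `K[x_1, …, x_n]` are given by their exponent vectors `u : Fin n →₀ ℕ`;
the element `i : Fin n` stands for the variable `x_{i+1}`. -/

/-- The monomial with exponent vector `u` lies in `I`. -/
def MonMem {K : Type*} [Field K] {n : ℕ} (I : Ideal (MvPolynomial (Fin n) K))
    (u : Fin n →₀ ℕ) : Prop :=
  monomial u (1 : K) ∈ I

/-- The ideal generated by the monomials with exponent vectors in `A`. -/
def monomialSpan (K : Type*) [Field K] {n : ℕ} (A : Set (Fin n →₀ ℕ)) :
    Ideal (MvPolynomial (Fin n) K) :=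
  Ideal.span ((fun u => monomial u (1 : K)) '' A)

/-- Monomial ideals: ideals generated by monomials. -/
def IsMonomialIdeal {K : Type*} [Field K] {n : ℕ} (I : Ideal (MvPolynomial (Fin n) K)) : Prop :=
  ∃ A : Set (Fin n →₀ ℕ), I = monomialSpan K A

/-- A squarefree monomial. -/
def SqfreeMon {n : ℕ} (u : Fin n →₀ ℕ) : Prop := ∀ i, u i ≤ 1

/-- Squarefree monomial ideals: ideals generated by squarefree monomials. -/
def IsSqfreeIdeal {K : Type*} [Field K] {n : ℕ} (I : Ideal (MvPolynomial (Fin n) K)) : Prop :=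
  ∃ A : Set (Fin n →₀ ℕ), (∀ u ∈ A, SqfreeMon u) ∧ I = monomialSpan K A

/-- `G(I)`: the monomials of `I` that are minimal with respect to divisibility. For a monomial
ideal this is its unique minimal system of monomial generators. -/
def minGens {K : Type*} [Field K] {n : ℕ} (I : Ideal (MvPolynomial (Fin n) K)) :
    Set (Fin n →₀ ℕ) :=
  {u | Minimal (MonMem I) u}

/-- `k` is the largest index of a variable dividing the monomial `u`. -/
def IsMaxVar {n : ℕ} (u : Fin n →₀ ℕ) (k : Fin n) : Prop :=
  IsGreatest {i | i ∈ u.support} k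

/-- `m(u)`, the largest index of a variable dividing `u`, with variables numbered from `1`
(and `m(1) = 0`). -/
def maxVar {n : ℕ} (u : Fin n →₀ ℕ) : ℕ := u.support.sup fun i => (i : ℕ) + 1

/-- The monomial `x_i (u / x_k)`, for `x_k` dividing `u`. -/
def exchange {n : ℕ} (u : Fin n →₀ ℕ) (k i : Fin n) : Fin n →₀ ℕ :=
  u - Finsupp.single k 1 + Finsupp.single i 1

/-- Stable monomial ideals. -/
def IsStable {K : Type*} [Field K] {n : ℕ} (I : Ideal (MvPolynomial (Fin n) K)) : Prop :=
  IsMonomialIdeal I ∧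
    ∀ u, MonMem I u → ∀ k, IsMaxVar u k → ∀ i < k, MonMem I (exchange u k i)

/-- Squarefree stable ideals. -/
def IsSqfreeStable {K : Type*} [Field K] {n : ℕ} (I : Ideal (MvPolynomial (Fin n) K)) : Prop :=
  IsSqfreeIdeal I ∧
    ∀ u, SqfreeMon u → MonMem I u → ∀ k, IsMaxVar u k → ∀ i < k, i ∉ u.support →
      MonMem I (exchange u k i)

/-- The linear change of variables `x_j ↦ ∑ i, g i j * x_i`. -/
def linearSubst {K : Type*} [Field K] {n : ℕ} (g : Matrix (Fin n) (Fin n) K) :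
    MvPolynomial (Fin n) K →ₐ[K] MvPolynomial (Fin n) K :=
  aeval fun j => ∑ i, C (g i j) * X i

/-- Borel-fixed ideals: invariant under all invertible upper triangular linear changes of
variables, that is, `x_j ↦ ∑ i ≤ j, g i j * x_i` with all `g j j ≠ 0`. -/
def IsBorelFixed {K : Type*} [Field K] {n : ℕ} (I : Ideal (MvPolynomial (Fin n) K)) : Prop :=
  ∀ g : Matrix (Fin n) (Fin n) K, g.BlockTriangular id → IsUnit g.det →
    I.map (linearSubst g) = I

/-- For `u = x_{i_1} x_{i_2} ⋯ x_{i_d}` with `i_1 ≤ i_2 ≤ ⋯ ≤ i_d`, the list of indices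
`i_1, i_2 + 1, …, i_d + (d - 1)`. -/
def sigmaIndices {n : ℕ} (u : Fin n →₀ ℕ) : List ℕ :=
  ((Finsupp.toMultiset u).sort (· ≤ ·)).mapIdx fun j i => (i : ℕ) + j

/-- The monomial `u^σ` in `N` variables. It is meant for `m(u) + deg u - 1 ≤ N`, when all of
`sigmaIndices u` are indices of variables. -/
def sigmaMon {n : ℕ} (N : ℕ) (u : Fin n →₀ ℕ) : Fin N →₀ ℕ :=
  Finsupp.equivFunOnFinite.symm fun k => (sigmaIndices u).count (k : ℕ)

/-- The ideal `I^σ` of the polynomial ring in `N` variables, generated by the `u^σ` with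
`u ∈ G(I)`. -/
def sigmaIdeal {K : Type*} [Field K] {n : ℕ} (N : ℕ) (I : Ideal (MvPolynomial (Fin n) K)) :
    Ideal (MvPolynomial (Fin N) K) :=
  monomialSpan K (sigmaMon N '' minGens I)

/-- `p` is homogeneous of degree `e`, where `e` is an integer (so `p = 0` if `e < 0`). -/
def IsHomogOfDegree {K : Type*} [Field K] {n : ℕ} (p : MvPolynomial (Fin n) K) (e : ℤ) : Prop :=
  ∀ c ∈ p.support, (c.degree : ℤ) = e

/-- A minimal graded free resolution
`⋯ → F_2 → F_1 → F_0 → I → 0` of an ideal `I` of `S = K[x_1, …, x_n]`. The module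
`F_i = ⊕ S(-deg i b)` has a finite basis `b : basis i`, the basis element `b` being of degree
`deg i b`; the maps `F_{i+1} → F_i` and `F_0 → I` are homogeneous of degree `0`, the sequence is
exact, and the image of `F_{i+1}` lies in `(x_1, …, x_n) F_i`. -/
structure MinGradedFreeResolution {K : Type*} [Field K] {n : ℕ}
    (I : Ideal (MvPolynomial (Fin n) K)) where
  basis : ℕ → Type
  [basisFintype : ∀ i, Fintype (basis i)]
  deg : ∀ i, basis i → ℤ
  /-- The images of the basis elements of `F_0` in `I`. -/
  gen : basis 0 → MvPolynomial (Fin n) K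
  /-- The matrix of `F_{i+1} → F_i`. -/
  d : ∀ i, Matrix (basis i) (basis (i + 1)) (MvPolynomial (Fin n) K)
  gen_homog : ∀ b, IsHomogOfDegree (gen b) (deg 0 b)
  d_homog : ∀ i b c, IsHomogOfDegree (d i b c) (deg (i + 1) c - deg i b)
  range_gen : LinearMap.range (Fintype.linearCombination (MvPolynomial (Fin n) K) gen) = I
  exact_zero : LinearMap.range (d 0).mulVecLin =
    LinearMap.ker (Fintype.linearCombination (MvPolynomial (Fin n) K) gen)
  exact_succ : ∀ i, LinearMap.range (d (i + 1)).mulVecLin = LinearMap.ker (d i).mulVecLin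
  minimal : ∀ i b c, d i b c ∈ Ideal.span (Set.range (X : Fin n → MvPolynomial (Fin n) K))

attribute [instance] MinGradedFreeResolution.basisFintype

/-- The graded Betti number read off a minimal graded free resolution: the number of
summands `S(-j)` of `F_i`. -/
def MinGradedFreeResolution.betti {K : Type*} [Field K] {n : ℕ}
    {I : Ideal (MvPolynomial (Fin n) K)} (F : MinGradedFreeResolution I) (i : ℕ) (j : ℤ) : ℕ :=
  (Finset.univ.filter fun b : F.basis i => F.deg i b = j).card

end

end SqfreeShift

namespace SqfreeShift

open MvPolynomial

noncomputable section

/-! ### Homogeneous components in integer degrees -/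

section Homogeneous

variable {K : Type*} [Field K] {n : ℕ}

/-! Squarefree stable ideals and stable ideals are the cases `c = 1` and `c = ⊤` of one notion,
`IsBoundedStable c`, and have an Eliahou–Kervaire type resolution of the same shape. Order the
minimal generators by degree, then by the sum of their indices. The colon ideal of the earlier
generators by a generator `v` is generated by the variables `exchangeVars c v`. Adding generators
one at a time by mapping cones over resolutions of these colon ideals (`exists_cone`,
`exists_resolution`) is minimal for degree reasons, so every `v` contributes `(exchangeVars c
v).card.choose i` to the Betti number in homological degree `i` and internal degree `i + deg v`, and
to no other internal degree. Betti numbers do not depend on the minimal resolution (`betti_eq`), so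
it remains to match these data for `u` and `u^σ`.

The combinatorics uses the inverse of the shift: an element `k` of the index set `W` of `u^σ` comes
from the variable of `u` with index `gapsBelow W k`, the number of gaps of `W` below `k`. Both sets
of exchange variables then have `gapsBelow W (max W)` elements (`card_exchangeVars_sigmaMon`), and
`u` and `u^σ` have the same degree.

That `I^σ` is squarefree stable with generators exactly the `u^σ` follows from translating
operations on `W` into operations on `u`. Deleting the maximum of `W` deletes the last variable of
`u`. Replacing the maximum by a smaller gap is a stable exchange followed by lowering some variables
(`monMem_of_unshift_exchange`). Enlarging `W` lowers variables, equal ones to equal ones, and adds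
factors (`monMem_of_unshift_subset`). Borel-fixedness allows precisely such lowering of whole powers
of variables (`monMem_mapDomain`). -/

/-- The homogeneous component of degree `e`, where `e` is an integer. -/
def homogComp (e : ℤ) : MvPolynomial (Fin n) K →ₗ[K] MvPolynomial (Fin n) K :=
  if 0 ≤ e then homogeneousComponent e.toNat else 0

theorem coeff_homogComp (e : ℤ) (p : MvPolynomial (Fin n) K) (m : Fin n →₀ ℕ) :
    coeff m (homogComp e p) = if (m.degree : ℤ) = e then coeff m p else 0 := by
  unfold homogComp
  split_ifs with h1 h2 h2
  · rw [coeff_homogeneousComponent, if_pos (by omega)]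
  · rw [coeff_homogeneousComponent, if_neg (by omega)]
  · omega
  · simp

theorem isHomogOfDegree_iff {p : MvPolynomial (Fin n) K} {e : ℤ} :
    IsHomogOfDegree p e ↔ ∀ m, (m.degree : ℤ) ≠ e → coeff m p = 0 := by
  unfold IsHomogOfDegree
  refine forall_congr' fun m => ?_
  rw [mem_support_iff]
  tauto

theorem isHomogOfDegree_homogComp (e : ℤ) (p : MvPolynomial (Fin n) K) :
    IsHomogOfDegree (homogComp e p) e := by
  rw [isHomogOfDegree_iff]
  intro m hm
  rw [coeff_homogComp, if_neg hm]

theorem IsHomogOfDegree.homogComp_eq {p : MvPolynomial (Fin n) K} {e : ℤ}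
    (h : IsHomogOfDegree p e) : homogComp e p = p := by
  rw [isHomogOfDegree_iff] at h
  ext m
  rw [coeff_homogComp]
  split_ifs with hm
  · rfl
  · exact (h m hm).symm

theorem IsHomogOfDegree.homogComp_mul {p : MvPolynomial (Fin n) K} {a : ℤ}
    (hp : IsHomogOfDegree p a) (b : ℤ) (q : MvPolynomial (Fin n) K) :
    homogComp (a + b) (p * q) = p * homogComp b q := by
  classical
  rw [isHomogOfDegree_iff] at hp
  ext m
  rw [coeff_homogComp, coeff_mul, coeff_mul]
  have key : ∀ x ∈ Finset.HasAntidiagonal.antidiagonal m, coeff x.1 p * coeff x.2 (homogComp b q) =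
      if (m.degree : ℤ) = a + b then coeff x.1 p * coeff x.2 q else 0 := by
    intro x hx
    rw [Finset.HasAntidiagonal.mem_antidiagonal] at hx
    have hd : m.degree = x.1.degree + x.2.degree := by rw [← hx, map_add]
    rw [coeff_homogComp]
    by_cases h1 : (x.1.degree : ℤ) = a
    · have : ((x.2.degree : ℤ) = b) ↔ ((m.degree : ℤ) = a + b) := by omega
      simp only [this]
      split_ifs <;> simp
    · rw [hp _ h1]
      simp
  rw [Finset.sum_congr rfl key]
  split_ifs <;> simp

theorem IsHomogOfDegree.mul {p q : MvPolynomial (Fin n) K} {a b : ℤ}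
    (hp : IsHomogOfDegree p a) (hq : IsHomogOfDegree q b) : IsHomogOfDegree (p * q) (a + b) := by
  rw [← hq.homogComp_eq, ← hp.homogComp_mul]
  exact isHomogOfDegree_homogComp _ _

theorem IsHomogOfDegree.neg {p : MvPolynomial (Fin n) K} {a : ℤ}
    (hp : IsHomogOfDegree p a) : IsHomogOfDegree (-p) a := by
  rw [isHomogOfDegree_iff] at hp ⊢
  intro m hm
  rw [coeff_neg, hp m hm, neg_zero]

theorem isHomogOfDegree_zero (a : ℤ) : IsHomogOfDegree (0 : MvPolynomial (Fin n) K) a := by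
  simp [isHomogOfDegree_iff]

theorem IsHomogOfDegree.sum {ι : Type*} {s : Finset ι} {f : ι → MvPolynomial (Fin n) K} {a : ℤ}
    (h : ∀ i ∈ s, IsHomogOfDegree (f i) a) : IsHomogOfDegree (∑ i ∈ s, f i) a := by
  rw [isHomogOfDegree_iff]
  intro m hm
  rw [coeff_sum]
  exact Finset.sum_eq_zero fun i hi => isHomogOfDegree_iff.1 (h i hi) m hm

theorem isHomogOfDegree_monomial (u : Fin n →₀ ℕ) (c : K) :
    IsHomogOfDegree (monomial u c) (u.degree : ℤ) := by
  classical
  rw [isHomogOfDegree_iff]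
  intro m hm
  rw [coeff_monomial, if_neg]
  rintro rfl
  exact hm rfl

theorem mem_span_X_iff {p : MvPolynomial (Fin n) K} :
    p ∈ Ideal.span (Set.range (X : Fin n → MvPolynomial (Fin n) K)) ↔ constantCoeff p = 0 := by
  rw [← Set.image_univ, mem_ideal_span_X_image, constantCoeff_eq]
  constructor
  · intro h
    by_contra h0
    obtain ⟨i, -, hi⟩ := h 0 (mem_support_iff.2 h0)
    exact hi rfl
  · intro h0 m hm
    by_contra! hc
    have : m = 0 := by
      ext i
      simpa using hc i (Set.mem_univ i)
    rw [this] at hm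
    exact (mem_support_iff.1 hm) h0

theorem IsHomogOfDegree.constantCoeff_eq_zero {p : MvPolynomial (Fin n) K} {e : ℤ}
    (hp : IsHomogOfDegree p e) (he : e ≠ 0) : constantCoeff p = 0 := by
  rw [isHomogOfDegree_iff] at hp
  rw [constantCoeff_eq]
  exact hp 0 (by simpa using he.symm)

/-! ### Graded matrices -/

variable {a b c : Type*}

/-- The matrix `M` describes a homogeneous map of degree `0` between graded free modules with
bases `a` and `b` in degrees `da` and `db`. -/
def IsGradedMatrix (da : a → ℤ) (db : b → ℤ) (M : Matrix b a (MvPolynomial (Fin n) K)) : Prop :=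
  ∀ y x, IsHomogOfDegree (M y x) (da x - db y)

theorem IsGradedMatrix.mul [Fintype b] {da : a → ℤ} {db : b → ℤ} {dc : c → ℤ}
    {M : Matrix c b (MvPolynomial (Fin n) K)} {M' : Matrix b a (MvPolynomial (Fin n) K)}
    (hM : IsGradedMatrix db dc M) (hM' : IsGradedMatrix da db M') :
    IsGradedMatrix da dc (M * M') := by
  intro z x
  rw [Matrix.mul_apply]
  refine IsHomogOfDegree.sum fun y _ => ?_
  have := (hM z y).mul (hM' y x)
  convert this using 1
  ring

theorem IsGradedMatrix.neg {da : a → ℤ} {db : b → ℤ}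
    {M : Matrix b a (MvPolynomial (Fin n) K)} (hM : IsGradedMatrix da db M) :
    IsGradedMatrix da db (-M) := fun y x => (hM y x).neg

theorem isGradedMatrix_one [DecidableEq a] (da : a → ℤ) :
    IsGradedMatrix da da (1 : Matrix a a (MvPolynomial (Fin n) K)) := by
  intro y x
  rw [Matrix.one_apply]
  split_ifs with h
  · subst h
    simpa using isHomogOfDegree_monomial (0 : Fin n →₀ ℕ) (1 : K)
  · exact isHomogOfDegree_zero _

/-- If all columns of `E` lie in the image of `D`, then `E` factors through `D`. -/
theorem exists_mul_eq_of_range_le {R : Type*} [CommRing R] [Fintype a] [Fintype c]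
    {D : Matrix b a R} {E : Matrix b c R}
    (h : LinearMap.range E.mulVecLin ≤ LinearMap.range D.mulVecLin) :
    ∃ X : Matrix a c R, D * X = E := by
  classical
  have h' : ∀ z, ∃ v : a → R, D.mulVec v = E.col z := by
    intro z
    have : E.mulVecLin (Pi.single z 1) ∈ LinearMap.range D.mulVecLin := h ⟨_, rfl⟩
    obtain ⟨v, hv⟩ := this
    refine ⟨v, ?_⟩
    rw [Matrix.mulVecLin_apply, Matrix.mulVecLin_apply, Matrix.mulVec_single_one] at hv
    exact hv
  choose v hv using h'
  refine ⟨Matrix.of fun x z => v z x, ?_⟩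
  ext y z
  have := congrFun (hv z) y
  simpa [Matrix.mul_apply, Matrix.mulVec, dotProduct] using this

/-- A factorization through a graded matrix of a graded matrix can be chosen graded. -/
theorem exists_graded_mul_eq_of_range_le [Fintype a] [Fintype c]
    {da : a → ℤ} {db : b → ℤ} {dc : c → ℤ}
    {D : Matrix b a (MvPolynomial (Fin n) K)} {E : Matrix b c (MvPolynomial (Fin n) K)}
    (hD : IsGradedMatrix da db D) (hE : IsGradedMatrix dc db E)
    (h : LinearMap.range E.mulVecLin ≤ LinearMap.range D.mulVecLin) :
    ∃ X : Matrix a c (MvPolynomial (Fin n) K), IsGradedMatrix dc da X ∧ D * X = E := by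
  obtain ⟨X, hX⟩ := exists_mul_eq_of_range_le h
  -- Replace each entry of an arbitrary solution by its component of the required degree. Since `D`
  -- is graded, multiplying by `D` then yields the component of `E` of its own degree, which is `E`.
  refine ⟨Matrix.of fun x z => homogComp (dc z - da x) (X x z),
    fun x z => isHomogOfDegree_homogComp _ _, ?_⟩
  ext1 y z
  rw [← (hE y z).homogComp_eq, ← hX, Matrix.mul_apply, Matrix.mul_apply, map_sum]
  refine Finset.sum_congr rfl fun x _ => ?_
  rw [Matrix.of_apply, ← (hD y x).homogComp_mul]
  congr 1
  ring_nf

theorem range_le_ker_of_mul_eq_zero {R : Type*} [CommRing R] [Fintype a] [Fintype b]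
    {D : Matrix c a R} {E : Matrix a b R} (h : D * E = 0) :
    LinearMap.range E.mulVecLin ≤ LinearMap.ker D.mulVecLin := by
  rw [LinearMap.range_le_ker_iff, ← Matrix.mulVecLin_mul, h, Matrix.mulVecLin_zero]

theorem mul_eq_zero_of_range_le_ker {R : Type*} [CommRing R] [Fintype a] [Fintype b]
    {D : Matrix c a R} {E : Matrix a b R}
    (h : LinearMap.range E.mulVecLin ≤ LinearMap.ker D.mulVecLin) : D * E = 0 := by
  classical
  rw [LinearMap.range_le_ker_iff, ← Matrix.mulVecLin_mul] at h
  ext y x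
  have := congrFun (LinearMap.congr_fun h (Pi.single x 1)) y
  rw [Matrix.mulVecLin_apply, Matrix.mulVec_single_one] at this
  exact this

/-- Degree-preserving matrices with a one-sided inverse bound the number of basis elements in
each degree. -/
theorem card_degree_le_of_mul_eq_one [Fintype a] [Fintype b] [DecidableEq a]
    {da : a → ℤ} {db : b → ℤ} {A : Matrix b a K} {B : Matrix a b K} (h : B * A = 1)
    (hA : ∀ y x, da x ≠ db y → A y x = 0) (j : ℤ) :
    (Finset.univ.filter fun x => da x = j).card ≤ (Finset.univ.filter fun y => db y = j).card := by
  classical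
  let ia : {x // da x = j} → a := Subtype.val
  let ib : {y // db y = j} → b := Subtype.val
  -- `A` vanishes between different degrees, so the degree-`j` blocks alone still multiply to the
  -- identity, and the rank bounds their size.
  have h1 : B.submatrix ia ib * A.submatrix ib ia = 1 := by
    ext x x'
    have := congrFun (congrFun h x.1) x'.1
    rw [Matrix.mul_apply] at this ⊢
    rw [Matrix.one_apply] at this ⊢
    simp only [Subtype.ext_iff]
    rw [← this]
    refine (Finset.sum_subtype (Finset.univ.filter fun y => db y = j) (by simp)
      (fun y => B x.1 y * A y x'.1)).symm.trans ?_
    refine Finset.sum_subset (Finset.subset_univ _) fun y _ hy => ?_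
    rw [hA y x'.1, mul_zero]
    rw [x'.2]
    simpa [eq_comm] using hy
  have h2 := Matrix.rank_mul_le_left (B.submatrix ia ib) (A.submatrix ib ia)
  rw [h1, Matrix.rank_one] at h2
  have h3 := h2.trans (Matrix.rank_le_card_width _)
  rwa [Fintype.card_subtype, Fintype.card_subtype] at h3

/-! ### Comparison of resolutions -/

variable {b₀ b₁ b₂ c₀ c₁ c₂ : Type*}

/-- Graded maps `φ`, `ψ` between two free modules, compatible with the images of `dF` and `dG`,
such that `ψ φ` restricted to the image of `dF` is homotopic to the identity. -/
def HomotopyRetract [Fintype b₀] [Fintype b₁] [Fintype c₀] [Fintype c₁] [DecidableEq b₀]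
    (δb : b₀ → ℤ) (δc : c₀ → ℤ)
    (dF : Matrix b₀ b₁ (MvPolynomial (Fin n) K)) (dG : Matrix c₀ c₁ (MvPolynomial (Fin n) K)) :
    Prop :=
  ∃ (φ : Matrix c₀ b₀ (MvPolynomial (Fin n) K)) (ψ : Matrix b₀ c₀ (MvPolynomial (Fin n) K))
    (h : Matrix b₁ b₀ (MvPolynomial (Fin n) K)),
    IsGradedMatrix δb δc φ ∧ IsGradedMatrix δc δb ψ ∧
    LinearMap.range (φ * dF).mulVecLin ≤ LinearMap.range dG.mulVecLin ∧
    LinearMap.range (ψ * dG).mulVecLin ≤ LinearMap.range dF.mulVecLin ∧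
    (ψ * φ - 1) * dF = dF * h * dF ∧ (h * dF).map constantCoeff = 0

/-- The usual comparison argument, one homological degree at a time. Exactness lifts `φ`, `ψ` to
`φ'`, `ψ'` and gives `ψ' φ' - 1 = eF h' + h dF`. Both terms on the right vanish modulo the
variables, so the constant terms of `ψ' φ'` form the identity, which bounds the ranks degree by
degree. -/
theorem HomotopyRetract.step [Fintype b₀] [Fintype b₁] [Fintype b₂] [Fintype c₀] [Fintype c₁]
    [Fintype c₂] [DecidableEq b₀] [DecidableEq b₁]
    {δb : b₀ → ℤ} {δc : c₀ → ℤ} {δb₁ : b₁ → ℤ} {δc₁ : c₁ → ℤ}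
    {dF : Matrix b₀ b₁ (MvPolynomial (Fin n) K)} {dG : Matrix c₀ c₁ (MvPolynomial (Fin n) K)}
    {eF : Matrix b₁ b₂ (MvPolynomial (Fin n) K)} {eG : Matrix c₁ c₂ (MvPolynomial (Fin n) K)}
    (H : HomotopyRetract δb δc dF dG)
    (hdF : IsGradedMatrix δb₁ δb dF) (hdG : IsGradedMatrix δc₁ δc dG)
    (exF : LinearMap.range eF.mulVecLin = LinearMap.ker dF.mulVecLin)
    (exG : LinearMap.range eG.mulVecLin = LinearMap.ker dG.mulVecLin)
    (mF : eF.map constantCoeff = 0) :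
    HomotopyRetract δb₁ δc₁ eF eG ∧ ∀ j, (Finset.univ.filter fun x => δb₁ x = j).card ≤
      (Finset.univ.filter fun y => δc₁ y = j).card := by
  obtain ⟨φ, ψ, h, hφ, hψ, rφ, rψ, hh, hm⟩ := H
  obtain ⟨φ', hφ', eφ⟩ := exists_graded_mul_eq_of_range_le hdG (hφ.mul hdF) rφ
  obtain ⟨ψ', hψ', eψ⟩ := exists_graded_mul_eq_of_range_le hdF (hψ.mul hdG) rψ
  have zF : dF * eF = 0 := mul_eq_zero_of_range_le_ker exF.le
  have zG : dG * eG = 0 := mul_eq_zero_of_range_le_ker exG.le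
  have key : dF * (ψ' * φ' - 1 - h * dF) = 0 := by
    rw [Matrix.mul_sub, Matrix.mul_sub, ← Matrix.mul_assoc, eψ, Matrix.mul_assoc, eφ,
      ← Matrix.mul_assoc dF h dF, ← hh, Matrix.sub_mul, Matrix.mul_assoc, Matrix.one_mul,
      Matrix.mul_one, sub_self]
  obtain ⟨h', eh⟩ := exists_mul_eq_of_range_le ((range_le_ker_of_mul_eq_zero key).trans exF.ge)
  have hid : ψ' * φ' - 1 = eF * h' + h * dF := by rw [eh]; abel
  refine ⟨⟨φ', ψ', h', hφ', hψ', ?_, ?_, ?_, ?_⟩, ?_⟩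
  · rw [exG]
    apply range_le_ker_of_mul_eq_zero
    rw [← Matrix.mul_assoc, eφ, Matrix.mul_assoc, zF, Matrix.mul_zero]
  · rw [exF]
    apply range_le_ker_of_mul_eq_zero
    rw [← Matrix.mul_assoc, eψ, Matrix.mul_assoc, zG, Matrix.mul_zero]
  · rw [hid, Matrix.add_mul, Matrix.mul_assoc h, zF, Matrix.mul_zero, add_zero]
  · rw [Matrix.map_mul, mF, Matrix.mul_zero]
  · have h1 : ψ'.map constantCoeff * φ'.map constantCoeff = (1 : Matrix b₁ b₁ K) := by
      have : ψ' * φ' = 1 + (eF * h' + h * dF) := by rw [← hid]; abel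
      rw [← Matrix.map_mul, this, Matrix.map_add _ (map_add _), Matrix.map_add _ (map_add _), hm,
        Matrix.map_mul, mF, Matrix.zero_mul, add_zero, add_zero,
        Matrix.map_one _ (map_zero _) (map_one _)]
    refine card_degree_le_of_mul_eq_one h1 fun y x hxy => ?_
    exact (hφ' y x).constantCoeff_eq_zero (sub_ne_zero.2 hxy)

end Homogeneous

/-! ### Independence of the graded Betti numbers of the resolution -/

section Betti

variable {K : Type*} [Field K] {n : ℕ} {I : Ideal (MvPolynomial (Fin n) K)}

/-- The augmentation `F_0 → I` as a matrix with one row. -/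
def MinGradedFreeResolution.genMatrix (F : MinGradedFreeResolution I) :
    Matrix Unit (F.basis 0) (MvPolynomial (Fin n) K) :=
  Matrix.of fun _ b => F.gen b

theorem MinGradedFreeResolution.genMatrix_mulVec (F : MinGradedFreeResolution I)
    (v : F.basis 0 → MvPolynomial (Fin n) K) (x : Unit) :
    F.genMatrix.mulVec v x = Fintype.linearCombination (MvPolynomial (Fin n) K) F.gen v := by
  simp [genMatrix, Matrix.mulVec, dotProduct, Fintype.linearCombination_apply, mul_comm]

theorem MinGradedFreeResolution.mem_range_genMatrix (F : MinGradedFreeResolution I)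
    (w : Unit → MvPolynomial (Fin n) K) :
    w ∈ LinearMap.range F.genMatrix.mulVecLin ↔ w () ∈ I := by
  have h : w () ∈ I ↔ w () ∈ LinearMap.range
      (Fintype.linearCombination (MvPolynomial (Fin n) K) F.gen) := by rw [F.range_gen]
  rw [h, LinearMap.mem_range, LinearMap.mem_range]
  refine exists_congr fun v => ?_
  rw [← F.genMatrix_mulVec v (), Matrix.mulVecLin_apply]
  exact ⟨fun h => congrFun h (), fun h => funext fun _ => h⟩

theorem MinGradedFreeResolution.ker_genMatrix (F : MinGradedFreeResolution I) :
    LinearMap.ker F.genMatrix.mulVecLin =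
      LinearMap.ker (Fintype.linearCombination (MvPolynomial (Fin n) K) F.gen) := by
  ext v
  rw [LinearMap.mem_ker, LinearMap.mem_ker, ← F.genMatrix_mulVec v (), Matrix.mulVecLin_apply]
  exact ⟨fun h => congrFun h (), fun h => funext fun _ => h⟩

theorem MinGradedFreeResolution.isGradedMatrix_genMatrix (F : MinGradedFreeResolution I) :
    IsGradedMatrix (F.deg 0) (fun _ => 0) F.genMatrix := fun _ b => by
  simpa [genMatrix] using F.gen_homog b

theorem MinGradedFreeResolution.map_constantCoeff_d (F : MinGradedFreeResolution I) (i : ℕ) :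
    (F.d i).map constantCoeff = 0 := by
  ext b c
  exact mem_span_X_iff.1 (F.minimal i b c)

open Classical in
theorem MinGradedFreeResolution.homotopyRetract_genMatrix (F G : MinGradedFreeResolution I) :
    HomotopyRetract (fun _ => 0) (fun _ => 0) F.genMatrix G.genMatrix := by
  have h : LinearMap.range F.genMatrix.mulVecLin = LinearMap.range G.genMatrix.mulVecLin := by
    ext w
    rw [F.mem_range_genMatrix, G.mem_range_genMatrix]
  -- The homotopy `0` makes the constant-term condition hold even for the unit ideal, when the
  -- augmentation has entries outside the maximal ideal.
  refine ⟨1, 1, 0, isGradedMatrix_one _, isGradedMatrix_one _, ?_, ?_, ?_, ?_⟩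
  · rw [Matrix.one_mul, h]
  · rw [Matrix.one_mul, h]
  · simp
  · simp

open Classical in
theorem MinGradedFreeResolution.homotopyRetract_d (F G : MinGradedFreeResolution I) (i : ℕ) :
    HomotopyRetract (F.deg i) (G.deg i) (F.d i) (G.d i) ∧ ∀ j, F.betti i j ≤ G.betti i j := by
  induction i with
  | zero =>
    exact (F.homotopyRetract_genMatrix G).step F.isGradedMatrix_genMatrix
      G.isGradedMatrix_genMatrix (F.exact_zero.trans F.ker_genMatrix.symm)
      (G.exact_zero.trans G.ker_genMatrix.symm) (F.map_constantCoeff_d 0)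
  | succ i ih =>
    exact ih.1.step (F.d_homog i) (G.d_homog i) (F.exact_succ i) (G.exact_succ i)
      (F.map_constantCoeff_d (i + 1))

/-- The graded Betti numbers do not depend on the minimal graded free resolution. -/
theorem MinGradedFreeResolution.betti_eq (F G : MinGradedFreeResolution I) (i : ℕ) (j : ℤ) :
    F.betti i j = G.betti i j :=
  le_antisymm ((F.homotopyRetract_d G i).2 j) ((G.homotopyRetract_d F i).2 j)

end Betti

/-! ### Mapping cones -/

section Cone

variable {K : Type*} [Field K] {n : ℕ} {I L : Ideal (MvPolynomial (Fin n) K)}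

/-- Multiplication by `-u : L → I` lifts to a graded map of resolutions, up to signs. -/
theorem MinGradedFreeResolution.exists_lift (F : MinGradedFreeResolution I)
    (H : MinGradedFreeResolution L) {u : MvPolynomial (Fin n) K} {e : ℤ}
    (hu : IsHomogOfDegree u e) (huL : ∀ p ∈ L, p * u ∈ I) :
    ∃ θ : ∀ i, Matrix (F.basis i) (H.basis i) (MvPolynomial (Fin n) K),
      (∀ i, IsGradedMatrix (fun c => H.deg i c + e) (F.deg i) (θ i)) ∧
      F.genMatrix * θ 0 = -(u • H.genMatrix) ∧
      ∀ i, F.d i * θ (i + 1) = -(θ i * H.d i) := by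
  have hd : ∀ i, IsGradedMatrix (fun c => H.deg (i + 1) c + e) (fun c => H.deg i c + e) (H.d i) := by
    intro i b c
    have := H.d_homog i b c
    convert this using 1
    ring
  -- The range condition is carried along because it is what permits lifting to the next degree.
  let Good : ∀ i, Matrix (F.basis i) (H.basis i) (MvPolynomial (Fin n) K) → Prop := fun i θ =>
    IsGradedMatrix (fun c => H.deg i c + e) (F.deg i) θ ∧
      LinearMap.range (θ * H.d i).mulVecLin ≤ LinearMap.range (F.d i).mulVecLin
  have h0 : ∃ θ, Good 0 θ ∧ F.genMatrix * θ = -(u • H.genMatrix) := by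
    have hg : IsGradedMatrix (fun c => H.deg 0 c + e) (fun _ => 0) (-(u • H.genMatrix)) := by
      refine IsGradedMatrix.neg fun y x => ?_
      have := hu.mul (H.isGradedMatrix_genMatrix y x)
      change IsHomogOfDegree (u * H.genMatrix y x) (H.deg 0 x + e - 0)
      convert this using 1
      simp only [sub_zero]
      ring
    obtain ⟨θ, hθ, e1⟩ := exists_graded_mul_eq_of_range_le F.isGradedMatrix_genMatrix hg (by
      rintro w ⟨v, rfl⟩
      rw [F.mem_range_genMatrix, Matrix.mulVecLin_apply, Matrix.neg_mulVec, Matrix.smul_mulVec,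
        Pi.neg_apply, Pi.smul_apply, smul_eq_mul, mul_comm]
      refine I.neg_mem (huL _ ?_)
      rw [← H.mem_range_genMatrix (H.genMatrix.mulVec v)]
      exact ⟨v, rfl⟩)
    refine ⟨θ, ⟨hθ, ?_⟩, e1⟩
    rw [F.exact_zero, ← F.ker_genMatrix]
    apply range_le_ker_of_mul_eq_zero
    rw [← Matrix.mul_assoc, e1, Matrix.neg_mul, Matrix.smul_mul,
      mul_eq_zero_of_range_le_ker (H.exact_zero.trans H.ker_genMatrix.symm).le, smul_zero, neg_zero]
  have hs : ∀ i (θ : {θ // Good i θ}), ∃ θ' : {θ' // Good (i + 1) θ'},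
      F.d i * θ'.1 = -(θ.1 * H.d i) := by
    rintro i ⟨θ, hθ, hr⟩
    obtain ⟨θ', hθ', e1⟩ := exists_graded_mul_eq_of_range_le (F.d_homog i) (hθ.mul (hd i)).neg (by
      rintro w ⟨v, rfl⟩
      rw [Matrix.mulVecLin_apply, Matrix.neg_mulVec]
      exact neg_mem (hr ⟨v, rfl⟩))
    refine ⟨⟨θ', hθ', ?_⟩, e1⟩
    rw [F.exact_succ]
    apply range_le_ker_of_mul_eq_zero
    rw [← Matrix.mul_assoc, e1, Matrix.neg_mul, Matrix.mul_assoc,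
      mul_eq_zero_of_range_le_ker (H.exact_succ i).le, Matrix.mul_zero, neg_zero]
  choose next hnext using hs
  obtain ⟨θ0, hθ0, e0⟩ := h0
  let θ : ∀ i, {θ // Good i θ} := fun i => Nat.rec ⟨θ0, hθ0⟩ (fun i t => next i t) i
  exact ⟨fun i => (θ i).1, fun i => (θ i).2.1, e0, fun i => hnext i (θ i)⟩

/-- The bases of the mapping cone. -/
def coneBasis (F : MinGradedFreeResolution I) (H : MinGradedFreeResolution L) : ℕ → Type
  | 0 => F.basis 0 ⊕ Unit
  | i + 1 => F.basis (i + 1) ⊕ H.basis i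

instance coneBasisFintype (F : MinGradedFreeResolution I) (H : MinGradedFreeResolution L) :
    ∀ i, Fintype (coneBasis F H i)
  | 0 => inferInstanceAs (Fintype (F.basis 0 ⊕ Unit))
  | i + 1 => inferInstanceAs (Fintype (F.basis (i + 1) ⊕ H.basis i))

/-- The degrees of the basis elements of the mapping cone. -/
def coneDeg (F : MinGradedFreeResolution I) (H : MinGradedFreeResolution L) (e : ℤ) :
    ∀ i, coneBasis F H i → ℤ
  | 0 => Sum.elim (F.deg 0) (fun _ => e)
  | i + 1 => Sum.elim (F.deg (i + 1)) (fun c => H.deg i c + e)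

/-- The differentials of the mapping cone. -/
def coneD (F : MinGradedFreeResolution I) (H : MinGradedFreeResolution L)
    (θ : ∀ i, Matrix (F.basis i) (H.basis i) (MvPolynomial (Fin n) K)) :
    ∀ i, Matrix (coneBasis F H i) (coneBasis F H (i + 1)) (MvPolynomial (Fin n) K)
  | 0 => Matrix.fromBlocks (F.d 0) (θ 0) 0 H.genMatrix
  | i + 1 => Matrix.fromBlocks (F.d (i + 1)) (θ (i + 1)) 0 (H.d i)

/-- Exactness of a sequence of block triangular matrices. -/
theorem fromBlocks_exact {R : Type*} [CommRing R] {a₀ a₁ a₂ b₀ b₁ b₂ : Type*}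
    [Fintype a₁] [Fintype a₂] [Fintype b₁] [Fintype b₂]
    {A : Matrix a₀ a₁ R} {A' : Matrix a₁ a₂ R} {B : Matrix b₀ b₁ R} {B' : Matrix b₁ b₂ R}
    {T : Matrix a₀ b₁ R} {T' : Matrix a₁ b₂ R}
    (hA : LinearMap.range A'.mulVecLin = LinearMap.ker A.mulVecLin)
    (hB : ∀ v : a₁ → R, ∀ w : b₁ → R, A.mulVec v + T.mulVec w = 0 → B.mulVec w = 0 →
      w ∈ LinearMap.range B'.mulVecLin)
    (hBB : B * B' = 0) (hT : A * T' = -(T * B')) :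
    LinearMap.range (Matrix.fromBlocks A' T' 0 B').mulVecLin =
      LinearMap.ker (Matrix.fromBlocks A T 0 B).mulVecLin := by
  apply le_antisymm
  · apply range_le_ker_of_mul_eq_zero
    rw [Matrix.fromBlocks_multiply, mul_eq_zero_of_range_le_ker hA.le, hT, hBB]
    simp [Matrix.fromBlocks_zero]
  · intro x hx
    rw [LinearMap.mem_ker, Matrix.mulVecLin_apply, Matrix.fromBlocks_mulVec] at hx
    have h1 : A.mulVec (x ∘ Sum.inl) + T.mulVec (x ∘ Sum.inr) = 0 := by
      funext y
      exact congrFun hx (Sum.inl y)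
    have h2 : B.mulVec (x ∘ Sum.inr) = 0 := by
      funext y
      simpa using congrFun hx (Sum.inr y)
    obtain ⟨w, hw⟩ := hB _ _ h1 h2
    rw [Matrix.mulVecLin_apply] at hw
    have h3 : x ∘ Sum.inl - T'.mulVec w ∈ LinearMap.ker A.mulVecLin := by
      rw [LinearMap.mem_ker, Matrix.mulVecLin_apply, Matrix.mulVec_sub, Matrix.mulVec_mulVec, hT,
        Matrix.neg_mulVec, ← Matrix.mulVec_mulVec, hw, sub_neg_eq_add, h1]
    rw [← hA] at h3
    obtain ⟨v, hv⟩ := h3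
    rw [Matrix.mulVecLin_apply] at hv
    refine ⟨Sum.elim v w, ?_⟩
    rw [Matrix.mulVecLin_apply, Matrix.fromBlocks_mulVec]
    funext y
    rcases y with y | y
    · simp [hv]
    · simp [hw]

theorem card_filter_sum {α β : Type*} [Fintype α] [Fintype β] (p : α ⊕ β → Prop)
    [DecidablePred p] :
    (Finset.univ.filter p).card = (Finset.univ.filter fun a => p (Sum.inl a)).card +
      (Finset.univ.filter fun b => p (Sum.inr b)).card := by
  simp only [Finset.card_filter, Fintype.sum_sum_type]

/-- The mapping cone: a minimal graded free resolution of `I + (u)` from resolutions of `I` and of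
`L = I : u`, if the degrees force it to be minimal. -/
theorem MinGradedFreeResolution.exists_cone (F : MinGradedFreeResolution I)
    (H : MinGradedFreeResolution L) {u : MvPolynomial (Fin n) K} {e : ℤ}
    (hu : IsHomogOfDegree u e) (huL : ∀ p, p * u ∈ I ↔ p ∈ L)
    (hL : L ≤ Ideal.span (Set.range X)) (hdeg : ∀ i b c, F.deg i b < H.deg i c + e) :
    ∃ F' : MinGradedFreeResolution (I ⊔ Ideal.span {u}),
      (∀ j, F'.betti 0 j = F.betti 0 j + if j = e then 1 else 0) ∧
      ∀ i j, F'.betti (i + 1) j = F.betti (i + 1) j + H.betti i (j - e) := by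
  obtain ⟨θ, hθ, e0, es⟩ := F.exists_lift H hu (fun p hp => (huL p).2 hp)
  -- By `hdeg` every entry of `θ` is homogeneous of nonzero degree, hence has no constant term.
  have hθm : ∀ i b c, θ i b c ∈ Ideal.span (Set.range (X : Fin n → MvPolynomial (Fin n) K)) :=
    fun i b c => mem_span_X_iff.2 ((hθ i b c).constantCoeff_eq_zero
      (sub_ne_zero.2 (hdeg i b c).ne'))
  have hgen : ∀ c, H.gen c ∈ L := by
    classical
    intro c
    have : LinearMap.range (Fintype.linearCombination (MvPolynomial (Fin n) K) H.gen) ≤ L :=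
      H.range_gen.le
    apply this
    exact ⟨Pi.single c 1, by simp⟩
  have hlc : ∀ v : F.basis 0 ⊕ Unit → MvPolynomial (Fin n) K,
      Fintype.linearCombination (MvPolynomial (Fin n) K) (Sum.elim F.gen fun _ : Unit => u) v =
      Fintype.linearCombination (MvPolynomial (Fin n) K) F.gen (v ∘ Sum.inl) +
        v (Sum.inr ()) * u := by
    intro v
    simp [Fintype.linearCombination_apply, Fintype.sum_sum_type]
  -- A zero second block row is added to the augmentation so that exactness at `F_0 ⊕ S(-e)` is also
  -- a case of `fromBlocks_exact`.
  have hker : LinearMap.ker (Fintype.linearCombination (MvPolynomial (Fin n) K)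
      (Sum.elim F.gen fun _ : Unit => u)) = LinearMap.ker
      (Matrix.fromBlocks F.genMatrix (Matrix.of fun _ _ : Unit => u) 0
        (0 : Matrix Unit Unit (MvPolynomial (Fin n) K))).mulVecLin := by
    ext v
    rw [LinearMap.mem_ker, LinearMap.mem_ker, hlc, Matrix.mulVecLin_apply,
      Matrix.fromBlocks_mulVec, ← F.genMatrix_mulVec _ ()]
    have : (Matrix.of fun _ _ : Unit => u).mulVec (v ∘ Sum.inr) () = v (Sum.inr ()) * u := by
      simp [Matrix.mulVec, dotProduct, mul_comm]
    rw [← this]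
    constructor
    · intro h
      funext y
      rcases y with y | y
      · exact h
      · simp
    · intro h
      exact congrFun h (Sum.inl ())
  refine ⟨{ basis := coneBasis F H
            deg := coneDeg F H e
            gen := Sum.elim F.gen fun _ => u
            d := coneD F H θ
            gen_homog := ?_
            d_homog := ?_
            range_gen := ?_
            exact_zero := ?_
            exact_succ := ?_
            minimal := ?_ }, ?_, ?_⟩
  · rintro (b | b)
    · exact F.gen_homog b
    · exact hu
  · rintro (_ | i) (b | b) (c | c)
    · exact F.d_homog 0 b c
    · exact hθ 0 b c
    · exact isHomogOfDegree_zero _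
    · have := H.gen_homog c
      change IsHomogOfDegree (H.gen c) (H.deg 0 c + e - e)
      rwa [add_sub_cancel_right]
    · exact F.d_homog (i + 1) b c
    · exact hθ (i + 1) b c
    · exact isHomogOfDegree_zero _
    · have := H.d_homog i b c
      change IsHomogOfDegree (H.d i b c) (H.deg (i + 1) c + e - (H.deg i b + e))
      rwa [add_sub_add_right_eq_sub]
  · ext p
    constructor
    · rintro ⟨v, rfl⟩
      refine (hlc v).symm ▸ ?_
      refine Submodule.add_mem_sup ?_ (Ideal.mul_mem_left _ _ (Ideal.mem_span_singleton_self u))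
      exact F.range_gen.le ⟨_, rfl⟩
    · intro hp
      obtain ⟨q, hq, r, hr, rfl⟩ := Submodule.mem_sup.1 hp
      obtain ⟨s, rfl⟩ := Ideal.mem_span_singleton'.1 hr
      rw [← F.range_gen] at hq
      obtain ⟨v, rfl⟩ := hq
      exact ⟨Sum.elim v fun _ => s, (hlc _).trans (by simp)⟩
  · refine Eq.trans ?_ hker.symm
    refine fromBlocks_exact (F.exact_zero.trans F.ker_genMatrix.symm) ?_ (Matrix.zero_mul _) ?_
    -- A relation `gen v + w u = 0` puts `w u` in `I`, so `w` lies in the colon ideal `L`, the image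
    -- of the augmentation of `H`. Here the colon condition takes the place of exactness of the
    -- lower row.
    · intro v w h _
      rw [H.mem_range_genMatrix, ← huL]
      have h1 := congrFun h ()
      have h2 : (Matrix.of fun _ _ : Unit => u).mulVec w () = w () * u := by
        simp [Matrix.mulVec, dotProduct, mul_comm]
      rw [Pi.add_apply, h2, Pi.zero_apply] at h1
      rw [eq_neg_of_add_eq_zero_right h1]
      exact I.neg_mem ((F.mem_range_genMatrix (F.genMatrix.mulVec v)).1 ⟨v, rfl⟩)
    · rw [e0]
      ext x y
      simp [Matrix.mul_apply]
  · rintro (_ | i)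
    · exact fromBlocks_exact (F.exact_succ 0)
        (fun v w _ h => (H.exact_zero.trans H.ker_genMatrix.symm).ge h)
        (mul_eq_zero_of_range_le_ker (H.exact_zero.trans H.ker_genMatrix.symm).le) (es 0)
    · exact fromBlocks_exact (F.exact_succ (i + 1)) (fun v w _ h => (H.exact_succ i).ge h)
        (mul_eq_zero_of_range_le_ker (H.exact_succ i).le) (es (i + 1))
  · rintro (_ | i) (b | b) (c | c)
    · exact F.minimal 0 b c
    · exact hθm 0 b c
    · exact Ideal.zero_mem _
    · exact hL (hgen c)
    · exact F.minimal (i + 1) b c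
    · exact hθm (i + 1) b c
    · exact Ideal.zero_mem _
    · exact H.minimal i b c
  · intro j
    refine (card_filter_sum (α := F.basis 0) (β := Unit)
      (fun b => Sum.elim (F.deg 0) (fun _ => e) b = j)).trans ?_
    congr 1
    simp only [Sum.elim_inr, Finset.card_filter, Finset.univ_unique, Finset.sum_singleton, eq_comm]
  · intro i j
    refine (card_filter_sum (α := F.basis (i + 1)) (β := H.basis i)
      (fun b => Sum.elim (F.deg (i + 1)) (fun c => H.deg i c + e) b = j)).trans ?_
    congr 1
    simp only [Sum.elim_inr, betti, eq_sub_iff_add_eq]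
    congr!

end Cone

/-! ### Monomial ideals -/

section MonomialIdeals

variable {K : Type*} [Field K] {n : ℕ} {I : Ideal (MvPolynomial (Fin n) K)}

theorem mem_monomialSpan {A : Set (Fin n →₀ ℕ)} {p : MvPolynomial (Fin n) K} :
    p ∈ monomialSpan K A ↔ ∀ m ∈ p.support, ∃ a ∈ A, a ≤ m :=
  mem_ideal_span_monomial_image

theorem monMem_monomialSpan {A : Set (Fin n →₀ ℕ)} {u : Fin n →₀ ℕ} :
    MonMem (monomialSpan K A) u ↔ ∃ a ∈ A, a ≤ u := by
  classical
  unfold MonMem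
  rw [mem_monomialSpan]
  simp [support_monomial]

theorem MonMem.mono {u v : Fin n →₀ ℕ} (hu : MonMem I u) (huv : u ≤ v) : MonMem I v := by
  obtain ⟨w, rfl⟩ := exists_add_of_le huv
  unfold MonMem at *
  rw [add_comm, ← mul_one (1 : K), ← monomial_mul]
  exact I.mul_mem_left _ hu

theorem MonMem.exists_minGens_le {u : Fin n →₀ ℕ} (hu : MonMem I u) : ∃ w ∈ minGens I, w ≤ u := by
  obtain ⟨w, hw, h⟩ := exists_minimal_le_of_wellFoundedLT (MonMem I) u hu
  exact ⟨w, h, hw⟩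

theorem minGens_finite (I : Ideal (MvPolynomial (Fin n) K)) : (minGens I).Finite :=
  WellQuasiOrderedLE.finite_of_isAntichain (setOfPred_minimal_antichain _)

theorem IsMonomialIdeal.mem_iff (hI : IsMonomialIdeal I) {p : MvPolynomial (Fin n) K} :
    p ∈ I ↔ ∀ m ∈ p.support, MonMem I m := by
  obtain ⟨A, rfl⟩ := hI
  rw [mem_monomialSpan]
  exact forall₂_congr fun m _ => monMem_monomialSpan.symm

theorem IsMonomialIdeal.eq_monomialSpan_minGens (hI : IsMonomialIdeal I) :
    I = monomialSpan K (minGens I) := by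
  ext p
  rw [hI.mem_iff, mem_monomialSpan]
  refine forall₂_congr fun m _ => ?_
  exact ⟨fun h => h.exists_minGens_le, fun ⟨a, ha, ham⟩ => MonMem.mono ha.1 ham⟩

theorem minGens_monomialSpan_of_antichain {A : Set (Fin n →₀ ℕ)}
    (hA : ∀ u ∈ A, ∀ v ∈ A, u ≤ v → u = v) : minGens (monomialSpan K A) = A := by
  ext u
  constructor
  · intro hu
    obtain ⟨a, ha, hau⟩ := monMem_monomialSpan.1 hu.1
    rwa [← hu.eq_of_le (monMem_monomialSpan.2 ⟨a, ha, le_rfl⟩) hau]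
  · intro hu
    refine ⟨monMem_monomialSpan.2 ⟨u, hu, le_rfl⟩, fun v hv hvu => ?_⟩
    obtain ⟨a, ha, hav⟩ := monMem_monomialSpan.1 hv
    rwa [← hA a ha u hu (hav.trans hvu)]

theorem exchange_add_single {u : Fin n →₀ ℕ} {k : Fin n} (hk : k ∈ u.support) (i : Fin n) :
    exchange u k i + Finsupp.single k 1 = u + Finsupp.single i 1 := by
  have h : Finsupp.single k 1 ≤ u := by
    rw [Finsupp.single_le_iff]
    exact Nat.one_le_iff_ne_zero.2 (Finsupp.mem_support_iff.1 hk)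
  rw [exchange, add_right_comm, tsub_add_cancel_of_le h]

theorem exchange_apply_of_ne {u : Fin n →₀ ℕ} {k i j : Fin n} (hjk : j ≠ k) (hji : j ≠ i) :
    exchange u k i j = u j := by
  simp [exchange, hjk.symm, hji.symm]

theorem exchange_apply_right {u : Fin n →₀ ℕ} {k i : Fin n} (hik : i ≠ k) :
    exchange u k i i = u i + 1 := by
  simp [exchange, hik.symm]

theorem exchange_apply_left {u : Fin n →₀ ℕ} {k i : Fin n} (hik : i ≠ k) :
    exchange u k i k = u k - 1 := by
  simp [exchange, hik]

theorem degree_exchange {u : Fin n →₀ ℕ} {k : Fin n} (hk : k ∈ u.support) (i : Fin n) :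
    (exchange u k i).degree = u.degree := by
  have := congrArg Finsupp.degree (exchange_add_single hk i)
  simpa using this

theorem exists_isMaxVar {u : Fin n →₀ ℕ} (hu : u ≠ 0) : ∃ k, IsMaxVar u k :=
  ⟨u.support.max' (Finsupp.support_nonempty_iff.2 hu), Finset.max'_mem _ _,
    fun _ hi => Finset.le_max' _ _ hi⟩

end MonomialIdeals

/-! ### Resolutions of ideals generated by variables -/

section Variables

variable {K : Type*} [Field K] {n : ℕ}

theorem MinGradedFreeResolution.betti_deg_ne_zero {I : Ideal (MvPolynomial (Fin n) K)}
    (F : MinGradedFreeResolution I) (i : ℕ) (b : F.basis i) : F.betti i (F.deg i b) ≠ 0 := by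
  unfold betti
  rw [Finset.card_ne_zero]
  exact ⟨b, by simp⟩

theorem exists_resolution_bot :
    ∃ F : MinGradedFreeResolution (⊥ : Ideal (MvPolynomial (Fin n) K)),
      ∀ i j, F.betti i j = 0 := by
  refine ⟨{ basis := fun _ => Empty
            deg := fun _ b => b.elim
            gen := fun b => b.elim
            d := fun _ => 0
            gen_homog := fun b => b.elim
            d_homog := fun _ b => b.elim
            range_gen := ?_
            exact_zero := Subsingleton.elim _ _
            exact_succ := fun _ => Subsingleton.elim _ _
            minimal := fun _ b => b.elim }, fun i j => ?_⟩
  · rw [LinearMap.range_eq_bot]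
    exact Subsingleton.elim _ _
  · simp [MinGradedFreeResolution.betti]

/-- This is the Koszul resolution as an iterated cone: `x_a` is a nonzerodivisor modulo the other
variables, so the colon ideal is again the ideal of `T` and `F` is used in both roles. The Betti
numbers add up by Pascal's rule. -/
theorem exists_resolution_variables (T : Finset (Fin n)) :
    ∃ F : MinGradedFreeResolution (Ideal.span (X '' (T : Set (Fin n))) :
      Ideal (MvPolynomial (Fin n) K)),
      ∀ (i : ℕ) (j : ℤ), F.betti i j = if j = i + 1 then T.card.choose (i + 1) else 0 := by
  classical
  induction T using Finset.induction_on with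
  | empty =>
    rw [Finset.coe_empty, Set.image_empty, Ideal.span_empty]
    obtain ⟨F, hF⟩ := exists_resolution_bot (K := K) (n := n)
    exact ⟨F, fun i j => by simp [hF]⟩
  | insert a T ha ih =>
    obtain ⟨F, hF⟩ := ih
    have hdeg : ∀ i b, F.deg i b = i + 1 := by
      intro i b
      have := F.betti_deg_ne_zero i b
      rw [hF] at this
      by_contra h
      exact this (if_neg h)
    have hX : IsHomogOfDegree (X a : MvPolynomial (Fin n) K) 1 := by
      have := isHomogOfDegree_monomial (Finsupp.single a 1) (1 : K)
      rwa [Finsupp.degree_single] at this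
    obtain ⟨F', h0, hs⟩ := F.exists_cone F hX (by
        intro p
        rw [mem_ideal_span_X_image, mem_ideal_span_X_image]
        constructor
        · intro h m hm
          obtain ⟨i, hi, hmi⟩ := h (m + Finsupp.single a 1) (by
            rw [mem_support_iff, coeff_mul_X]
            exact mem_support_iff.1 hm)
          refine ⟨i, hi, ?_⟩
          have hia : a ≠ i := by
            rintro rfl
            exact ha hi
          simpa [Finsupp.single_apply, hia] using hmi
        · intro h m hm
          rw [mem_support_iff, coeff_mul_X'] at hm
          split_ifs at hm with hma
          · obtain ⟨i, hi, hmi⟩ := h _ (mem_support_iff.2 hm)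
            refine ⟨i, hi, fun h0 => hmi ?_⟩
            simp [h0]
          · exact absurd rfl hm)
      (Ideal.span_mono (Set.image_subset_range _ _)) (by
        intro i b c
        rw [hdeg, hdeg]
        omega)
    have hI : Ideal.span (X '' ((insert a T : Finset (Fin n)) : Set (Fin n))) =
        Ideal.span (X '' (T : Set (Fin n))) ⊔
          Ideal.span {(X a : MvPolynomial (Fin n) K)} := by
      rw [Finset.coe_insert, Set.image_insert_eq, Ideal.span_insert, sup_comm]
    rw [hI]
    refine ⟨F', fun i j => ?_⟩
    rw [Finset.card_insert_of_notMem ha]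
    rcases i with _ | i
    · rw [h0, hF]
      by_cases hj : j = 1 <;> simp [hj]
    · rw [hs, hF, hF, Nat.choose_succ_succ T.card (i + 1)]
      by_cases hj : j = ((i + 1 : ℕ) : ℤ) + 1
      · rw [if_pos hj, if_pos hj, if_pos (by push_cast at hj ⊢; omega), add_comm]
      · rw [if_neg hj, if_neg hj, if_neg (by push_cast at hj ⊢; omega)]

end Variables

/-! ### Ideals stable under exchanges of monomials with bounded exponents -/

section BoundedStable

variable {K : Type*} [Field K] {n : ℕ} {I : Ideal (MvPolynomial (Fin n) K)} {c : ℕ∞}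

/-- All exponents of `u` are at most `c`. -/
def ExponentsLE (c : ℕ∞) (u : Fin n →₀ ℕ) : Prop := ∀ i, (u i : ℕ∞) ≤ c

/-- Stability with respect to monomials with exponents at most `c`. For `c = ⊤` these are the
stable ideals, for `c = 1` the squarefree stable ideals. -/
def IsBoundedStable (c : ℕ∞) (I : Ideal (MvPolynomial (Fin n) K)) : Prop :=
  ∀ u, ExponentsLE c u → MonMem I u → ∀ k, IsMaxVar u k → ∀ i < k,
    ExponentsLE c (exchange u k i) → MonMem I (exchange u k i)

/-- The variables `x_i` with `i < m(u)` and `x_i^c` not dividing `u`. -/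
def exchangeVars (c : ℕ∞) (u : Fin n →₀ ℕ) : Finset (Fin n) :=
  open Classical in Finset.univ.filter fun i => (u i : ℕ∞) < c ∧ ∃ k ∈ u.support, i < k

theorem mem_exchangeVars {u : Fin n →₀ ℕ} {i : Fin n} :
    i ∈ exchangeVars c u ↔ (u i : ℕ∞) < c ∧ ∃ k ∈ u.support, i < k := by
  simp [exchangeVars]

/-- The sum of the indices of the variables of `u`. -/
def indexSum : (Fin n →₀ ℕ) →+ ℕ := Finsupp.weight fun i : Fin n => (i : ℕ)

theorem indexSum_exchange_lt {u : Fin n →₀ ℕ} {k i : Fin n} (hk : k ∈ u.support) (hik : i < k) :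
    indexSum (exchange u k i) < indexSum u := by
  have := congrArg indexSum (exchange_add_single hk i)
  simp only [map_add, indexSum, Finsupp.weight_single, one_smul] at this
  have h : (i : ℕ) < k := hik
  simp only [indexSum]
  omega

/-- A monomial of a stable ideal can be pushed into `v` by exchanges, if its variables before the
last variable of `v` do not exceed those of `v`. -/
theorem IsBoundedStable.exists_le (hI : IsBoundedStable c I) {v : Fin n →₀ ℕ}
    (hv : ExponentsLE c v) (N : ℕ) : ∀ u : Fin n →₀ ℕ, ExponentsLE c u → MonMem I u →
      u.degree ≤ v.degree → (∀ i, (∃ k ∈ v.support, i < k) → u i ≤ v i) → (u - v).degree = N →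
      ∃ u' ≤ v, MonMem I u' ∧ u'.degree = u.degree ∧ (u' = u ∨ indexSum u' < indexSum u) := by
  induction N using Nat.strong_induction_on with
  | _ N ih =>
    intro u hu huI hdeg hle hN
    by_cases huv : u ≤ v
    · exact ⟨u, huv, huI, rfl, Or.inl rfl⟩
    obtain ⟨k₀, hk₀⟩ : ∃ k, v k < u k := by
      by_contra! h
      exact huv h
    -- By `hle`, an exponent of `u` can exceed that of `v` only at or after the last variable of
    -- `v`. Hence the last variable `k` of `u` also occurs in excess.
    have hk₀v : ∀ i ∈ v.support, i ≤ k₀ := by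
      intro i hi
      by_contra! h
      exact absurd (hle k₀ ⟨i, hi, h⟩) (by omega)
    obtain ⟨k, hk⟩ := exists_isMaxVar (u := u) (by rintro rfl; simp at hk₀)
    have hkk : k₀ ≤ k := hk.2 (Finsupp.mem_support_iff.2 (by omega))
    have hkv : v k < u k := by
      rcases hkk.eq_or_lt with h | h
      · rwa [← h]
      · have h0 : v k = 0 := by
          by_contra h1
          exact absurd (hk₀v k (Finsupp.mem_support_iff.2 h1)) (not_le.2 h)
        have := Finsupp.mem_support_iff.1 hk.1
        omega
    -- As `u` has excess at `k` but no larger degree, it has a deficit at some `i`. Exchanging `x_k`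
    -- for `x_i` brings `u` closer to dividing `v`.
    obtain ⟨i, hi⟩ : ∃ i, u i < v i := by
      by_contra! h
      have : v.degree < u.degree := by
        rw [Finsupp.degree_eq_sum, Finsupp.degree_eq_sum]
        exact Finset.sum_lt_sum (fun j _ => h j) ⟨k, Finset.mem_univ _, hkv⟩
      omega
    have hik : i < k := by
      have h1 : i ≤ k := (hk₀v i (Finsupp.mem_support_iff.2 (by omega))).trans hkk
      refine lt_of_le_of_ne h1 ?_
      rintro rfl
      omega
    have hmax : ∀ j, exchange u k i j ≤ u j ∨ exchange u k i j ≤ v j := by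
      intro j
      by_cases hji : j = i
      · subst hji
        rw [exchange_apply_right hik.ne]
        right
        omega
      · by_cases hjk : j = k
        · subst hjk
          rw [exchange_apply_left hik.ne]
          left
          omega
        · rw [exchange_apply_of_ne hjk hji]
          left
          exact le_rfl
    have hw : ExponentsLE c (exchange u k i) := by
      intro j
      rcases hmax j with h | h
      · exact le_trans (by exact_mod_cast h) (hu j)
      · exact le_trans (by exact_mod_cast h) (hv j)
    have hlt : (exchange u k i - v).degree < (u - v).degree := by
      rw [Finsupp.degree_eq_sum, Finsupp.degree_eq_sum]
      refine Finset.sum_lt_sum (fun j _ => ?_) ⟨k, Finset.mem_univ _, ?_⟩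
      · rw [Finsupp.tsub_apply, Finsupp.tsub_apply]
        rcases hmax j with h | h <;> omega
      · rw [Finsupp.tsub_apply, Finsupp.tsub_apply, exchange_apply_left hik.ne]
        omega
    obtain ⟨u', hu'v, hu'I, hu'd, hu'⟩ := ih _ (hN ▸ hlt) (exchange u k i) hw
      (hI u hu huI k hk i hik hw) (by rwa [degree_exchange hk.1]) (by
        intro j hj
        rcases hmax j with h | h
        · exact h.trans (hle j hj)
        · exact h) rfl
    refine ⟨u', hu'v, hu'I, hu'd.trans (degree_exchange hk.1 i), Or.inr ?_⟩
    have := indexSum_exchange_lt hk.1 hik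
    rcases hu' with rfl | h
    · exact this
    · exact h.trans this

/-- The order in which the generators are added. -/
def generatorKey (u : Fin n →₀ ℕ) : ℕ ×ₗ ℕ := toLex (u.degree, indexSum u)

theorem generatorKey_lt_iff {u v : Fin n →₀ ℕ} : generatorKey u < generatorKey v ↔
    u.degree < v.degree ∨ u.degree = v.degree ∧ indexSum u < indexSum v := by
  rw [generatorKey, generatorKey, Prod.Lex.toLex_lt_toLex]

theorem generatorKey_le_iff {u v : Fin n →₀ ℕ} : generatorKey u ≤ generatorKey v ↔
    u.degree < v.degree ∨ u.degree = v.degree ∧ indexSum u ≤ indexSum v := by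
  rw [generatorKey, generatorKey, Prod.Lex.toLex_le_toLex]

/-- One inclusion of the colon ideal computation: if an earlier generator `u` divides `m v`, some
exchange variable of `v` divides `m`. Otherwise `exists_le` pushes `u` into a divisor of `v` in `I`,
which is `v` by minimality. Then `u = v`, or `v` has the degree of `u` and a smaller index sum,
against the order. -/
theorem IsBoundedStable.exists_mem_exchangeVars (hI : IsBoundedStable c I)
    (hG : ∀ u ∈ minGens I, ExponentsLE c u) {u v : Fin n →₀ ℕ} (hu : u ∈ minGens I)
    (hv : v ∈ minGens I) (hne : u ≠ v) (hkey : generatorKey u ≤ generatorKey v) :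
    ∃ i ∈ exchangeVars c v, v i < u i := by
  by_contra! h
  rw [generatorKey_le_iff] at hkey
  obtain ⟨u', hu'v, hu'I, hu'd, hu'⟩ := hI.exists_le (hG v hv) _ u (hG u hu) hu.1 (by omega) (by
    intro i hi
    by_cases hic : (v i : ℕ∞) < c
    · exact h i (mem_exchangeVars.2 ⟨hic, hi⟩)
    · exact_mod_cast (hG u hu i).trans (not_lt.1 hic)) rfl
  have huv' : u' = v := hv.eq_of_le hu'I hu'v
  subst huv'
  rcases hu' with rfl | h1
  · exact hne rfl
  · omega

/-- The other inclusion: `x_i v` is a multiple of `x_i (v / x_k)`, which lies in `I` and has the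
same degree as `v` and smaller index sum, so any generator dividing it comes strictly earlier. -/
theorem IsBoundedStable.exists_generator_le (hI : IsBoundedStable c I)
    (hG : ∀ u ∈ minGens I, ExponentsLE c u) {v : Fin n →₀ ℕ} (hv : v ∈ minGens I) {i : Fin n}
    (hi : i ∈ exchangeVars c v) :
    ∃ w ∈ minGens I, generatorKey w < generatorKey v ∧ w ≤ v + Finsupp.single i 1 := by
  obtain ⟨hic, k', hk', hik'⟩ := mem_exchangeVars.1 hi
  obtain ⟨k, hk⟩ := exists_isMaxVar (u := v) (by rintro rfl; simp at hk')
  have hik : i < k := lt_of_lt_of_le hik' (hk.2 hk')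
  have hb : ExponentsLE c (exchange v k i) := by
    intro j
    by_cases hji : j = i
    · subst hji
      rw [exchange_apply_right hik.ne]
      push_cast
      exact Order.add_one_le_of_lt hic
    · refine le_trans ?_ (hG v hv j)
      by_cases hjk : j = k
      · subst hjk
        rw [exchange_apply_left hik.ne]
        exact_mod_cast Nat.sub_le _ _
      · rw [exchange_apply_of_ne hjk hji]
  obtain ⟨w, hw, hwle⟩ := (hI v (hG v hv) hv.1 k hk i hik hb).exists_minGens_le
  refine ⟨w, hw, ?_, ?_⟩
  · rw [generatorKey_lt_iff]
    obtain ⟨t, ht⟩ := exists_add_of_le hwle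
    have h1 := congrArg Finsupp.degree ht
    have h2 := congrArg indexSum ht
    rw [degree_exchange hk.1, map_add] at h1
    rw [map_add] at h2
    have := indexSum_exchange_lt hk.1 hik
    omega
  · refine hwle.trans ?_
    rw [← exchange_add_single hk.1]
    exact le_self_add

/-- The minimal graded free resolution of an ideal stable under exchanges. -/
theorem IsBoundedStable.exists_resolution (hI : IsBoundedStable c I) (hmon : IsMonomialIdeal I)
    (hG : ∀ u ∈ minGens I, ExponentsLE c u) :
    ∃ F : MinGradedFreeResolution I, ∀ (i : ℕ) (j : ℤ), F.betti i j =
      ∑ u ∈ (minGens_finite I).toFinset,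
        if j = i + u.degree then (exchangeVars c u).card.choose i else 0 := by
  classical
  -- Closure under strictly smaller keys suffices, so ties of `generatorKey` may be broken
  -- arbitrarily.
  suffices h : ∀ s : Finset (Fin n →₀ ℕ), (∀ u ∈ s, u ∈ minGens I) →
      (∀ u ∈ s, ∀ w ∈ minGens I, generatorKey w < generatorKey u → w ∈ s) →
      ∃ F : MinGradedFreeResolution (monomialSpan K (s : Set (Fin n →₀ ℕ))),
        ∀ (i : ℕ) (j : ℤ), F.betti i j =
          ∑ u ∈ s, if j = i + u.degree then (exchangeVars c u).card.choose i else 0 by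
    have := h (minGens_finite I).toFinset (by simp) (by simp +contextual)
    rwa [Set.Finite.coe_toFinset, ← hmon.eq_monomialSpan_minGens] at this
  intro s
  induction s using Finset.induction_on_max_value generatorKey with
  | empty =>
    intro _ _
    rw [Finset.coe_empty, monomialSpan, Set.image_empty, Ideal.span_empty]
    obtain ⟨F, hF⟩ := exists_resolution_bot (K := K) (n := n)
    exact ⟨F, fun i j => by simp [hF]⟩
  | insert a s ha hmax ih =>
    intro hsG hlow
    have haG : a ∈ minGens I := hsG a (Finset.mem_insert_self _ _)
    obtain ⟨F, hF⟩ := ih (fun u hu => hsG u (Finset.mem_insert_of_mem hu)) (by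
      intro u hu w hw hwu
      refine (Finset.mem_insert.1 (hlow u (Finset.mem_insert_of_mem hu) w hw hwu)).resolve_left ?_
      rintro rfl
      exact absurd (hmax u hu) (not_le.2 hwu))
    obtain ⟨H, hH⟩ := exists_resolution_variables (K := K) (exchangeVars c a)
    obtain ⟨F', h0, hs⟩ := F.exists_cone H (isHomogOfDegree_monomial a (1 : K)) (by
        intro p
        rw [mem_monomialSpan, mem_ideal_span_X_image]
        constructor
        · intro h m hm
          obtain ⟨u, hu, hum⟩ := h (m + a) (by
            rw [mem_support_iff, coeff_mul_monomial, mul_one]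
            exact mem_support_iff.1 hm)
          obtain ⟨i, hi, hlt⟩ := hI.exists_mem_exchangeVars hG
            (hsG u (Finset.mem_insert_of_mem hu)) haG (by rintro rfl; exact ha hu) (hmax u hu)
          refine ⟨i, hi, ?_⟩
          have := hum i
          rw [Finsupp.add_apply] at this
          omega
        · intro h m hm
          rw [mem_support_iff, coeff_mul_monomial'] at hm
          split_ifs at hm with ham
          · rw [mul_one] at hm
            obtain ⟨i, hi, hmi⟩ := h _ (mem_support_iff.2 hm)
            obtain ⟨w, hw, hwa, hwle⟩ := hI.exists_generator_le hG haG hi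
            refine ⟨w, ?_, ?_⟩
            · refine (Finset.mem_insert.1 (hlow a (Finset.mem_insert_self _ _) w hw
                hwa)).resolve_left ?_
              rintro rfl
              exact lt_irrefl _ hwa
            · refine hwle.trans ?_
              conv_rhs => rw [← add_tsub_cancel_of_le ham]
              refine add_le_add le_rfl ?_
              rw [Finsupp.single_le_iff]
              exact Nat.one_le_iff_ne_zero.2 hmi
          · exact absurd rfl hm)
      (Ideal.span_mono (Set.image_subset_range _ _)) (by
        intro i b b'
        have h1 := F.betti_deg_ne_zero i b
        have h2 := H.betti_deg_ne_zero i b'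
        rw [hF] at h1
        rw [hH] at h2
        obtain ⟨u, hu, hne⟩ := Finset.exists_ne_zero_of_sum_ne_zero h1
        have h3 : F.deg i b = i + u.degree := by
          by_contra hc
          exact hne (if_neg hc)
        have h4 : H.deg i b' = i + 1 := by
          by_contra hc
          exact h2 (if_neg hc)
        have h5 := generatorKey_le_iff.1 (hmax u hu)
        omega)
    have hspan : monomialSpan K ((insert a s : Finset _) : Set (Fin n →₀ ℕ)) =
        monomialSpan K (s : Set (Fin n →₀ ℕ)) ⊔ Ideal.span {monomial a (1 : K)} := by
      rw [monomialSpan, monomialSpan, Finset.coe_insert, Set.image_insert_eq, Ideal.span_insert,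
        sup_comm]
    rw [hspan]
    refine ⟨F', fun i j => ?_⟩
    rw [Finset.sum_insert ha, add_comm]
    rcases i with _ | i
    · rw [h0, hF]
      simp
    · rw [hs, hF, hH]
      congr 1
      refine if_congr ?_ rfl rfl
      push_cast
      omega

end BoundedStable

/-! ### Moving blocks of variables in Borel-fixed ideals -/

section Borel

variable {K : Type*} [Field K] {n : ℕ} {I : Ideal (MvPolynomial (Fin n) K)}

theorem IsMonomialIdeal.kill_variable_mem (hI : IsMonomialIdeal I) (j : Fin n)
    {p : MvPolynomial (Fin n) K} (hp : p ∈ I) :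
    aeval (fun l => if l = j then (0 : MvPolynomial (Fin n) K) else X l) p ∈ I := by
  obtain ⟨A, rfl⟩ := hI
  let ρ : MvPolynomial (Fin n) K →ₐ[K] MvPolynomial (Fin n) K :=
    aeval (fun l => if l = j then (0 : MvPolynomial (Fin n) K) else X l)
  suffices h : monomialSpan K A ≤ (monomialSpan K A).comap ρ from h hp
  refine Ideal.span_le.2 ?_
  rintro _ ⟨a, ha, rfl⟩
  change ρ (monomial a 1) ∈ monomialSpan K A
  have hmem : monomial a (1 : K) ∈ monomialSpan K A := Ideal.subset_span ⟨a, ha, rfl⟩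
  simp only [ρ]
  rw [aeval_monomial, map_one, one_mul]
  by_cases haj : a j = 0
  · have : (a.prod fun i k => (if i = j then (0 : MvPolynomial (Fin n) K) else X i) ^ k) =
        monomial a 1 := by
      rw [monomial_eq, C_1, one_mul]
      refine Finsupp.prod_congr fun i hi => ?_
      rw [if_neg]
      rintro rfl
      exact (Finsupp.mem_support_iff.1 hi) haj
    rwa [this]
  · have : (a.prod fun i k => (if i = j then (0 : MvPolynomial (Fin n) K) else X i) ^ k) = 0 := by
      refine Finset.prod_eq_zero (Finsupp.mem_support_iff.2 haj) ?_
      simp only [if_true, zero_pow haj]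
    rw [this]
    exact Ideal.zero_mem _

/-- The transvection `x_j ↦ x_j + x_i` followed by `x_j ↦ 0` is the substitution `x_j ↦ x_i`. The
first preserves `I` because it is Borel-fixed, the second because it is monomial. -/
theorem IsBorelFixed.monMem_moveBlock (hbf : IsBorelFixed I) (hI : IsMonomialIdeal I)
    {u : Fin n →₀ ℕ} (hu : MonMem I u) {i j : Fin n} (hij : i ≤ j) :
    MonMem I (u.mapDomain (Function.update id j i)) := by
  rcases hij.eq_or_lt with rfl | hlt
  · rwa [Function.update_eq_self_iff.2 (id_eq i).symm, Finsupp.mapDomain_id]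
  let g : Matrix (Fin n) (Fin n) K := Matrix.transvection i j 1
  have hg : g.BlockTriangular id := by
    intro a b hab
    have hab' : b < a := hab
    have h1 : ¬ (i = a ∧ j = b) := by
      rintro ⟨rfl, rfl⟩
      exact absurd hlt (not_lt.2 hab'.le)
    simp [g, Matrix.transvection, hab'.ne', h1]
  have hdet : IsUnit g.det := by
    rw [Matrix.det_transvection_of_ne i j hlt.ne]
    exact isUnit_one
  have h1 : linearSubst g (monomial u 1) ∈ I := by
    have := Ideal.mem_map_of_mem (linearSubst g) hu
    rwa [hbf g hg hdet] at this
  have h2 := hI.kill_variable_mem j h1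
  have h3 : (aeval (fun l => if l = j then (0 : MvPolynomial (Fin n) K) else X l)).comp
      (linearSubst g) = rename (Function.update id j i) := by
    apply algHom_ext
    intro l
    rw [AlgHom.comp_apply, linearSubst, aeval_X, map_sum, rename_X]
    simp only [map_mul, aeval_X, algHom_C, algebraMap_eq, g, Matrix.transvection,
      Matrix.add_apply, Matrix.one_apply, Matrix.single_apply, map_add, add_mul,
      Finset.sum_add_distrib]
    by_cases hl : l = j
    · subst hl
      simp [hlt.ne, apply_ite, ite_mul]
    · have hl' : j ≠ l := fun h => hl h.symm
      simp [hl, hl', apply_ite, ite_mul]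
  rw [← AlgHom.comp_apply, h3, rename_monomial] at h2
  exact h2

/-- In a Borel-fixed monomial ideal all variables of a monomial may be replaced by smaller ones,
as long as equal variables are replaced by equal ones. -/
theorem IsBorelFixed.monMem_mapDomain (hbf : IsBorelFixed I) (hI : IsMonomialIdeal I)
    {u : Fin n →₀ ℕ} (hu : MonMem I u) {f : Fin n → Fin n} (hf : ∀ j, f j ≤ j) :
    MonMem I (u.mapDomain f) := by
  -- Blocks are moved in increasing order of index. A block already moved sits at `f j ≤ j < t`, so
  -- later moves do not touch it.
  have key : ∀ t ≤ n, MonMem I (u.mapDomain fun j : Fin n => if (j : ℕ) < t then f j else j) := by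
    intro t
    induction t with
    | zero =>
      intro _
      have : (fun j : Fin n => if (j : ℕ) < 0 then f j else j) = id := by
        funext j
        simp
      rwa [this, Finsupp.mapDomain_id]
    | succ t ih =>
      intro ht
      have h := hbf.monMem_moveBlock hI (ih (by omega)) (hf ⟨t, ht⟩)
      rw [← Finsupp.mapDomain_comp] at h
      convert h using 2
      funext j
      simp only [Function.comp_apply]
      rcases lt_trichotomy (j : ℕ) t with hj | hj | hj
      · have h1 : f j ≠ ⟨t, ht⟩ := by
          intro h
          have h2 : (f j : ℕ) ≤ j := hf j
          rw [h] at h2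
          simp only at h2
          omega
        rw [if_pos hj, if_pos (by omega), Function.update_of_ne h1, id]
      · have h1 : j = ⟨t, ht⟩ := Fin.ext hj
        rw [if_pos (by omega), if_neg (by omega : ¬ (j : ℕ) < t), h1, Function.update_self]
      · have h1 : j ≠ ⟨t, ht⟩ := by
          rintro rfl
          simp at hj
        rw [if_neg (by omega), if_neg (by omega), Function.update_of_ne h1, id]
  have := key n le_rfl
  simpa using this

end Borel

/-! ### The inverse of the shift `u ↦ u^σ` on finite sets of indices -/

section Unshift

/-- The number of `l < k` with `l ∉ W`. -/
def gapsBelow (W : Finset ℕ) (k : ℕ) : ℕ := (Finset.range k \ W).card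

/-- The monomial `u` whose shift `u^σ` is the squarefree monomial with support `W`. -/
def unshift (W : Finset ℕ) : ℕ →₀ ℕ := ∑ k ∈ W, Finsupp.single (gapsBelow W k) 1

theorem gapsBelow_mono (W : Finset ℕ) {k l : ℕ} (h : k ≤ l) : gapsBelow W k ≤ gapsBelow W l :=
  Finset.card_le_card (Finset.sdiff_subset_sdiff (Finset.range_mono h) le_rfl)

theorem gapsBelow_anti {W V : Finset ℕ} (h : W ⊆ V) (k : ℕ) : gapsBelow V k ≤ gapsBelow W k :=
  Finset.card_le_card (Finset.sdiff_subset_sdiff le_rfl h)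

theorem gapsBelow_lt {W : Finset ℕ} {y k : ℕ} (hyk : y < k) (hy : y ∉ W) :
    gapsBelow W y < gapsBelow W k := by
  refine Finset.card_lt_card ((Finset.ssubset_iff_of_subset
    (Finset.sdiff_subset_sdiff (Finset.range_mono hyk.le) le_rfl)).2 ⟨y, ?_, ?_⟩)
  · simp [hyk, hy]
  · simp

theorem gapsBelow_congr {W V : Finset ℕ} {k : ℕ} (h : ∀ l < k, l ∈ W ↔ l ∈ V) :
    gapsBelow W k = gapsBelow V k := by
  unfold gapsBelow
  congr 1
  ext l
  simp only [Finset.mem_sdiff, Finset.mem_range]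
  constructor
  · rintro ⟨h1, h2⟩
    exact ⟨h1, fun h3 => h2 ((h l h1).2 h3)⟩
  · rintro ⟨h1, h2⟩
    exact ⟨h1, fun h3 => h2 ((h l h1).1 h3)⟩

/-- Equal gap counts at `k` and `l` mean that the interval from `k` to `l - 1` has no gaps in `W`,
hence none in `V`. -/
theorem gapsBelow_eq_of_subset {W V : Finset ℕ} (h : W ⊆ V) {k l : ℕ} (hkl : k ≤ l)
    (hW : gapsBelow W k = gapsBelow W l) : gapsBelow V k = gapsBelow V l := by
  refine le_antisymm (gapsBelow_mono V hkl) (Finset.card_le_card ?_)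
  intro x hx
  rw [Finset.mem_sdiff, Finset.mem_range] at hx ⊢
  refine ⟨?_, hx.2⟩
  by_contra! hkx
  have h1 := gapsBelow_lt hx.1 (fun hxW => hx.2 (h hxW))
  have h2 := gapsBelow_mono W hkx
  omega

theorem gapsBelow_add_card {W : Finset ℕ} {M : ℕ} (h : ∀ k ∈ W, k < M) :
    gapsBelow W M + W.card = M := by
  have hs : W ⊆ Finset.range M := fun k hk => Finset.mem_range.2 (h k hk)
  have := Finset.card_sdiff_add_card_eq_card hs
  rwa [Finset.card_range] at this

theorem gapsBelow_insert_self {W : Finset ℕ} (M : ℕ) :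
    gapsBelow (insert M W) M = gapsBelow W M := by
  apply gapsBelow_congr
  intro l hl
  simp [hl.ne]

theorem unshift_insert {W : Finset ℕ} {M : ℕ} (h : ∀ k ∈ W, k < M) :
    unshift (insert M W) = unshift W + Finsupp.single (gapsBelow W M) 1 := by
  have hM : M ∉ W := fun hM => lt_irrefl _ (h M hM)
  rw [unshift, Finset.sum_insert hM, add_comm, gapsBelow_insert_self, unshift]
  congr 1
  refine Finset.sum_congr rfl fun k hk => ?_
  rw [gapsBelow_congr fun l hl => ?_]
  have : l ≠ M := by
    have := h k hk
    omega
  simp [this]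

theorem degree_unshift (W : Finset ℕ) : (unshift W).degree = W.card := by
  simp [unshift, map_sum]

theorem mem_support_unshift {W : Finset ℕ} {a : ℕ} :
    a ∈ (unshift W).support ↔ ∃ k ∈ W, gapsBelow W k = a := by
  rw [Finsupp.mem_support_iff, unshift, Finsupp.finsetSum_apply, Ne, Finset.sum_eq_zero_iff]
  simp [Finsupp.single_apply]

/-- The last variable of `unshift W` is the gap count at the maximum of `W`, and the degree is the
cardinality of `W`. Together they determine the maximum, which is then removed. -/
theorem unshift_injective : Function.Injective unshift := by
  intro W
  induction W using Finset.induction_on_max with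
  | empty =>
    intro V h
    have := congrArg Finsupp.degree h
    rw [degree_unshift, degree_unshift, Finset.card_empty] at this
    exact (Finset.card_eq_zero.1 this.symm).symm
  | insert M W hM ih =>
    intro V h
    have hMW : M ∉ W := fun hM' => lt_irrefl _ (hM M hM')
    have hcard := congrArg Finsupp.degree h
    rw [degree_unshift, degree_unshift, Finset.card_insert_of_notMem hMW] at hcard
    have hVne : V.Nonempty := Finset.card_pos.1 (by omega)
    obtain ⟨M', V', hM', hV⟩ : ∃ M' V', (∀ k ∈ V', k < M') ∧ V = insert M' V' := by
      refine ⟨V.max' hVne, V.erase (V.max' hVne), fun k hk => ?_,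
        (Finset.insert_erase (Finset.max'_mem _ _)).symm⟩
      exact Finset.lt_max'_of_mem_erase_max' _ _ hk
    subst hV
    have hMV : M' ∉ V' := fun h' => lt_irrefl _ (hM' M' h')
    rw [Finset.card_insert_of_notMem hMV] at hcard
    have hle : ∀ {A B : Finset ℕ} {x y : ℕ}, (∀ k ∈ A, k < x) → (∀ k ∈ B, k < y) →
        unshift (insert x A) = unshift (insert y B) → gapsBelow A x ≤ gapsBelow B y := by
      intro A B x y hA hB hAB
      have h1 : gapsBelow A x ∈ (unshift (insert y B)).support := by
        rw [← hAB]
        exact mem_support_unshift.2 ⟨x, Finset.mem_insert_self _ _, gapsBelow_insert_self x⟩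
      obtain ⟨k, hk, hkx⟩ := mem_support_unshift.1 h1
      rw [← hkx, ← gapsBelow_insert_self (W := B) y]
      apply gapsBelow_mono
      rcases Finset.mem_insert.1 hk with rfl | hk
      · exact le_rfl
      · exact (hB k hk).le
    have heq : gapsBelow W M = gapsBelow V' M' := le_antisymm (hle hM hM' h) (hle hM' hM h.symm)
    have h1 := gapsBelow_add_card hM
    have h2 := gapsBelow_add_card hM'
    have hMM : M = M' := by omega
    subst hMM
    rw [unshift_insert hM, unshift_insert hM', heq] at h
    rw [ih (add_right_cancel h)]

end Unshift

/-! ### The set of indices of `u^σ` -/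

section SigmaSet

variable {n : ℕ}

/-- The set of indices of the variables of `u^σ`. -/
def sigmaSet (u : Fin n →₀ ℕ) : Finset ℕ := (sigmaIndices u).toFinset

/-- The monomial `u` in infinitely many variables. -/
def extend (u : Fin n →₀ ℕ) : ℕ →₀ ℕ := u.mapDomain (Fin.val : Fin n → ℕ)

theorem extend_apply (u : Fin n →₀ ℕ) (i : Fin n) : extend u i = u i :=
  Finsupp.mapDomain_apply Fin.val_injective u i

theorem extend_injective : Function.Injective (extend (n := n)) :=
  Finsupp.mapDomain_injective Fin.val_injective

theorem extend_add (u v : Fin n →₀ ℕ) : extend (u + v) = extend u + extend v :=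
  Finsupp.mapDomain_add

theorem extend_single (i : Fin n) (a : ℕ) : extend (Finsupp.single i a) = Finsupp.single (i : ℕ) a :=
  Finsupp.mapDomain_single

theorem mem_support_extend {u : Fin n →₀ ℕ} {a : ℕ} :
    a ∈ (extend u).support ↔ ∃ i ∈ u.support, (i : ℕ) = a := by
  classical
  rw [extend, Finsupp.mapDomain_support_of_injective Fin.val_injective]
  simp

theorem le_of_extend_le {u v : Fin n →₀ ℕ} (h : extend u ≤ extend v) : u ≤ v := by
  intro i
  have := h i
  rwa [extend_apply, extend_apply] at this

/-- The list `i_1, i_2 + 1, …, i_d + (d - 1)`. -/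
def shiftList (L : List (Fin n)) : List ℕ := L.mapIdx fun (j : ℕ) (i : Fin n) => (i : ℕ) + j

theorem shiftList_concat (L : List (Fin n)) (a : Fin n) :
    shiftList (L ++ [a]) = shiftList L ++ [(a : ℕ) + L.length] :=
  List.mapIdx_concat

theorem length_shiftList (L : List (Fin n)) : (shiftList L).length = L.length :=
  List.length_mapIdx

/-- The bound in the second claim shows that an appended entry exceeds all earlier ones. This gives
distinctness, and the gap count at `a + L.length` is `a` because all `L.length` earlier entries lie
below it. -/
theorem shiftList_spec (L : List (Fin n)) (hL : L.Pairwise (· ≤ ·)) :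
    (shiftList L).Nodup ∧
    (∀ b, (∀ x ∈ L, (x : ℕ) ≤ b) → ∀ s ∈ shiftList L, s < b + L.length) ∧
    unshift (shiftList L).toFinset = extend
      (Multiset.toFinsupp (L : Multiset (Fin n))) := by
  induction L using List.reverseRecOn with
  | nil => simp [shiftList, unshift, extend]
  | append_singleton L a ih =>
    rw [List.pairwise_append] at hL
    obtain ⟨h1, h2, h3⟩ := ih hL.1
    have hlt : ∀ s ∈ shiftList L, s < a + L.length :=
      h2 a fun x hx => hL.2.2 x hx a (by simp)
    rw [shiftList_concat]
    refine ⟨?_, ?_, ?_⟩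
    · rw [List.nodup_append]
      refine ⟨h1, by simp, ?_⟩
      intro s hs t ht
      rw [List.mem_singleton] at ht
      have := hlt s hs
      omega
    · intro b hb s hs
      have hab := hb a (by simp)
      rw [List.length_append, List.length_singleton]
      rcases List.mem_append.1 hs with hs | hs
      · have := hlt s hs
        omega
      · rw [List.mem_singleton] at hs
        omega
    · have hlt' : ∀ s ∈ (shiftList L).toFinset, s < a + L.length := by
        intro s hs
        exact hlt s (List.mem_toFinset.1 hs)
      have hc := gapsBelow_add_card hlt'
      rw [List.toFinset_card_of_nodup h1, length_shiftList] at hc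
      have hg : gapsBelow (shiftList L).toFinset (a + L.length) = a := by omega
      have hins : (shiftList L ++ [(a : ℕ) + L.length]).toFinset =
          insert ((a : ℕ) + L.length) (shiftList L).toFinset := by
        ext s
        simp
      rw [hins, unshift_insert hlt', hg, h3, ← Multiset.coe_add, Multiset.toFinsupp_add, extend_add,
        Multiset.coe_singleton, Multiset.toFinsupp_singleton, extend_single]

theorem sort_toMultiset_spec (u : Fin n →₀ ℕ) :
    (((Finsupp.toMultiset u).sort (· ≤ ·)).Pairwise (· ≤ ·)) ∧
    Multiset.toFinsupp (((Finsupp.toMultiset u).sort (· ≤ ·) : List (Fin n)) : Multiset (Fin n)) = u ∧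
    ((Finsupp.toMultiset u).sort (· ≤ ·)).length = u.degree := by
  refine ⟨Multiset.pairwise_sort _ _, ?_, ?_⟩
  · rw [Multiset.sort_eq, Finsupp.toMultiset_toFinsupp]
  · rw [Multiset.length_sort, Finsupp.card_toMultiset]
    rfl

theorem sigmaIndices_eq (u : Fin n →₀ ℕ) :
    sigmaIndices u = shiftList ((Finsupp.toMultiset u).sort (· ≤ ·)) := by
  unfold sigmaIndices shiftList
  simp only [List.bind_eq_flatMap, List.pure_def, ← List.map_eq_flatMap]
  exact List.ext_getElem (by simp) (by simp)

theorem nodup_sigmaIndices (u : Fin n →₀ ℕ) : (sigmaIndices u).Nodup :=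
  sigmaIndices_eq u ▸ (shiftList_spec _ (sort_toMultiset_spec u).1).1

theorem unshift_sigmaSet (u : Fin n →₀ ℕ) : unshift (sigmaSet u) = extend u := by
  have := (shiftList_spec _ (sort_toMultiset_spec u).1).2.2
  rwa [(sort_toMultiset_spec u).2.1, ← sigmaIndices_eq] at this

theorem sigmaSet_eq {u : Fin n →₀ ℕ} {W : Finset ℕ} (h : extend u = unshift W) : sigmaSet u = W :=
  unshift_injective ((unshift_sigmaSet u).trans h)

theorem sigmaSet_injective : Function.Injective (sigmaSet (n := n)) := by
  intro u v h
  apply extend_injective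
  rw [← unshift_sigmaSet, h, unshift_sigmaSet]

theorem card_sigmaSet (u : Fin n →₀ ℕ) : (sigmaSet u).card = u.degree := by
  rw [sigmaSet, List.toFinset_card_of_nodup (nodup_sigmaIndices u), sigmaIndices_eq,
    length_shiftList, (sort_toMultiset_spec u).2.2]

theorem lt_of_mem_sigmaSet {u : Fin n →₀ ℕ} {N : ℕ} (hN : maxVar u + u.degree ≤ N + 1) {s : ℕ}
    (hs : s ∈ sigmaSet u) : s < N := by
  have h := (shiftList_spec _ (sort_toMultiset_spec u).1).2.1 (maxVar u - 1) (by
    intro x hx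
    rw [Multiset.mem_sort, Finsupp.mem_toMultiset] at hx
    have : (x : ℕ) + 1 ≤ maxVar u := Finset.le_sup (f := fun i : Fin n => (i : ℕ) + 1) hx
    omega) s (sigmaIndices_eq u ▸ List.mem_toFinset.1 hs)
  rw [(sort_toMultiset_spec u).2.2] at h
  -- Needed because the subtraction in `maxVar u - 1` is truncated; `maxVar` counts variables from
  -- `1`, the indices in `sigmaSet` from `0`.
  have hu : 0 < maxVar u := by
    have h0 : 0 < (sigmaSet u).card := Finset.card_pos.2 ⟨s, hs⟩
    rw [card_sigmaSet] at h0
    have hne : u ≠ 0 := by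
      rintro rfl
      simp at h0
    obtain ⟨x, hx⟩ := Finsupp.support_nonempty_iff.2 hne
    exact lt_of_lt_of_le (Nat.succ_pos _) (Finset.le_sup (f := fun i : Fin n => (i : ℕ) + 1) hx)
  omega

theorem sigmaMon_apply (N : ℕ) (u : Fin n →₀ ℕ) (k : Fin N) :
    sigmaMon N u k = if (k : ℕ) ∈ sigmaSet u then 1 else 0 := by
  change (sigmaIndices u).count (k : ℕ) = _
  rw [sigmaSet]
  split_ifs with h
  · exact List.count_eq_one_of_mem (nodup_sigmaIndices u) (List.mem_toFinset.1 h)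
  · exact List.count_eq_zero.2 fun h' => h (List.mem_toFinset.2 h')

theorem mem_support_sigmaMon {N : ℕ} {u : Fin n →₀ ℕ} {k : Fin N} :
    k ∈ (sigmaMon N u).support ↔ (k : ℕ) ∈ sigmaSet u := by
  rw [Finsupp.mem_support_iff, sigmaMon_apply]
  simp

theorem sqfreeMon_sigmaMon (N : ℕ) (u : Fin n →₀ ℕ) : SqfreeMon (sigmaMon N u) := by
  intro k
  rw [sigmaMon_apply]
  split_ifs <;> simp

theorem sigmaMon_le_iff {N : ℕ} {u : Fin n →₀ ℕ} (hu : ∀ s ∈ sigmaSet u, s < N)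
    {w : Fin N →₀ ℕ} :
    sigmaMon N u ≤ w ↔ ∀ s (hs : s ∈ sigmaSet u), (⟨s, hu s hs⟩ : Fin N) ∈ w.support := by
  constructor
  · intro h s hs
    have := h ⟨s, hu s hs⟩
    rw [sigmaMon_apply, if_pos hs] at this
    exact Finsupp.mem_support_iff.2 (by omega)
  · intro h k
    rw [sigmaMon_apply]
    split_ifs with hk
    · exact Nat.one_le_iff_ne_zero.2 (Finsupp.mem_support_iff.1 (h k hk))
    · exact Nat.zero_le _

theorem sigmaSet_subset_of_sigmaMon_le {N : ℕ} {u v : Fin n →₀ ℕ} (hu : ∀ s ∈ sigmaSet u, s < N)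
    (h : sigmaMon N u ≤ sigmaMon N v) : sigmaSet u ⊆ sigmaSet v := fun s hs =>
  mem_support_sigmaMon.1 ((sigmaMon_le_iff hu).1 h s hs)

theorem degree_sigmaMon {N : ℕ} {u : Fin n →₀ ℕ} (hu : ∀ s ∈ sigmaSet u, s < N) :
    (sigmaMon N u).degree = u.degree := by
  rw [Finsupp.degree_eq_sum, ← card_sigmaSet]
  simp only [sigmaMon_apply]
  rw [Fin.sum_univ_eq_sum_range (fun k => if k ∈ sigmaSet u then 1 else 0) N,
    ← Finset.card_filter]
  congr 1
  ext s
  simp only [Finset.mem_filter, Finset.mem_range]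
  exact ⟨fun h => h.2, fun h => ⟨hu s h, h⟩⟩

end SigmaSet

/-! ### Monomials of a stable Borel-fixed ideal and their shifts -/

section Shift

variable {K : Type*} [Field K] {n : ℕ} {I : Ideal (MvPolynomial (Fin n) K)}

theorem IsBorelFixed.exists_extend_eq_mapDomain (hbf : IsBorelFixed I) (hI : IsMonomialIdeal I)
    {u : Fin n →₀ ℕ} (hu : MonMem I u) {f : ℕ → ℕ} (hf : ∀ j, f j ≤ j) :
    ∃ v, MonMem I v ∧ extend v = (extend u).mapDomain f := by
  refine ⟨_, hbf.monMem_mapDomain hI hu (f := fun j => ⟨f j, (hf j).trans_lt j.2⟩)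
    (fun j => hf j), ?_⟩
  rw [extend, extend, ← Finsupp.mapDomain_comp, ← Finsupp.mapDomain_comp]
  rfl

/-- Removing the last variable of a monomial of a stable ideal that is not a minimal generator. -/
theorem IsStable.monMem_sub_single (hst : IsStable I) {u : Fin n →₀ ℕ} (hu : MonMem I u)
    (hmin : u ∉ minGens I) {k : Fin n} (hk : IsMaxVar u k) :
    MonMem I (u - Finsupp.single k 1) := by
  obtain ⟨w, hw, hwu⟩ := hu.exists_minGens_le
  obtain ⟨j, hj⟩ : ∃ j, w j < u j := by
    by_contra! h
    exact hmin (le_antisymm hwu h ▸ hw)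
  have hju : j ∈ u.support := Finsupp.mem_support_iff.2 (by omega)
  have hle : w ≤ u - Finsupp.single j 1 := by
    intro l
    have := hwu l
    rw [Finsupp.tsub_apply, Finsupp.single_apply]
    split_ifs with h
    · subst h
      omega
    · omega
  have hmem := MonMem.mono hw.1 hle
  by_cases hjk : j = k
  · rwa [← hjk]
  · have hlt : j < k := lt_of_le_of_ne (hk.2 hju) hjk
    have hmax : IsMaxVar (u - Finsupp.single j 1) k := by
      refine ⟨?_, fun l hl => hk.2 ?_⟩
      · have := Finsupp.mem_support_iff.1 hk.1
        refine Finsupp.mem_support_iff.2 ?_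
        rwa [Finsupp.tsub_apply, Finsupp.single_apply, if_neg hjk]
      · have := Finsupp.mem_support_iff.1 hl
        rw [Finsupp.tsub_apply] at this
        exact Finsupp.mem_support_iff.2 (by omega)
    -- In `u / x_j` the last variable is still `x_k`; exchanging it for `x_j` gives `u / x_k`.
    have := hst.2 _ hmem k hmax j hlt
    have heq : exchange (u - Finsupp.single j 1) k j = u - Finsupp.single k 1 := by
      have h1 : Finsupp.single j 1 ≤ u - Finsupp.single k 1 := by
        rw [Finsupp.single_le_iff, Finsupp.tsub_apply, Finsupp.single_apply,
          if_neg (fun h => hjk h.symm)]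
        have := Finsupp.mem_support_iff.1 hju
        omega
      rw [exchange, tsub_right_comm, tsub_add_cancel_of_le h1]
    rwa [heq] at this

/-- The last variable of `u` and the last index of `u^σ`. -/
theorem exists_isMaxVar_unshift {u : Fin n →₀ ℕ} {W : Finset ℕ} (h : extend u = unshift W) {M : ℕ}
    (hM : IsGreatest (W : Set ℕ) M) :
    ∃ k : Fin n, IsMaxVar u k ∧ (k : ℕ) = gapsBelow W M ∧
      extend (u - Finsupp.single k 1) = unshift (W.erase M) ∧
      unshift W = unshift (W.erase M) + Finsupp.single (gapsBelow W M) 1 := by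
  have hlt : ∀ k ∈ W.erase M, k < M := fun k hk =>
    lt_of_le_of_ne (hM.2 (Finset.mem_of_mem_erase hk)) (Finset.ne_of_mem_erase hk)
  have hun := unshift_insert hlt
  rw [← gapsBelow_insert_self, Finset.insert_erase hM.1] at hun
  have hmem : gapsBelow W M ∈ (extend u).support := by
    rw [h]
    exact mem_support_unshift.2 ⟨M, hM.1, rfl⟩
  obtain ⟨k, hku, hk⟩ := mem_support_extend.1 hmem
  refine ⟨k, ⟨hku, fun l hl => ?_⟩, hk, ?_, hun⟩
  · have : (l : ℕ) ∈ (extend u).support := mem_support_extend.2 ⟨l, hl, rfl⟩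
    rw [h] at this
    obtain ⟨m, hm, hml⟩ := mem_support_unshift.1 this
    change (l : ℕ) ≤ k
    rw [← hml, hk]
    exact gapsBelow_mono W (hM.2 hm)
  · have h1 : Finsupp.single k 1 ≤ u := by
      rw [Finsupp.single_le_iff]
      exact Nat.one_le_iff_ne_zero.2 (Finsupp.mem_support_iff.1 hku)
    have h2 := congrArg extend (tsub_add_cancel_of_le h1)
    rw [extend_add, extend_single, h, hun, hk] at h2
    exact add_right_cancel h2

/-- As long as `u` is not a minimal generator, its last variable can be dropped within `I`, which
drops the maximum of `W`. -/
theorem IsStable.exists_minGens_subset (hst : IsStable I) (W : Finset ℕ) :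
    ∀ u : Fin n →₀ ℕ, MonMem I u → extend u = unshift W →
      ∃ w ∈ minGens I, sigmaSet w ⊆ W := by
  induction W using Finset.strongInduction with
  | H W ih =>
    intro u hu h
    by_cases hmin : u ∈ minGens I
    · exact ⟨u, hmin, (sigmaSet_eq h).le⟩
    have hne : W.Nonempty := by
      rw [Finset.nonempty_iff_ne_empty]
      rintro rfl
      refine hmin ⟨hu, fun v _ hv => ?_⟩
      have h0 : u = 0 := by
        apply extend_injective
        rw [h]
        simp [unshift, extend]
      rw [h0]
      exact zero_le
    have hM := W.isGreatest_max' hne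
    obtain ⟨k, hk, -, he, -⟩ := exists_isMaxVar_unshift h hM
    obtain ⟨w, hw, hwW⟩ := ih _ (Finset.erase_ssubset hM.1) _ (hst.monMem_sub_single hu hmin hk) he
    exact ⟨w, hw, hwW.trans (Finset.erase_subset _ _)⟩

/-- With `g = gapsBelow W y`, first exchange the last variable of `u` for the one with index `g`, by
stability. Filling the gap `y` costs each remaining element above `y` one gap. These are exactly the
remaining elements with gap count greater than `g`, so lowering all indices greater than `g` by one
gives the monomial of the new set. -/
theorem monMem_of_unshift_exchange (hst : IsStable I) (hbf : IsBorelFixed I) {u : Fin n →₀ ℕ}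
    (hu : MonMem I u) {W : Finset ℕ} (h : extend u = unshift W) {M y : ℕ}
    (hM : IsGreatest (W : Set ℕ) M) (hyM : y < M) (hy : y ∉ W) :
    ∃ v, MonMem I v ∧ extend v = unshift (insert y (W.erase M)) := by
  obtain ⟨k, hk, hkM, -, hun⟩ := exists_isMaxVar_unshift h hM
  have hgl := gapsBelow_lt hyM hy
  have hyn : gapsBelow W y < n := by
    have := k.2
    omega
  have hik : (⟨gapsBelow W y, hyn⟩ : Fin n) < k := by
    change gapsBelow W y < k
    omega
  have hw := hst.2 u hu k hk _ hik
  have he := congrArg extend (exchange_add_single hk.1 ⟨gapsBelow W y, hyn⟩)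
  rw [extend_add, extend_add, extend_single, extend_single, h, hun, hkM, add_right_comm] at he
  have he' := add_right_cancel he
  obtain ⟨v, hv, hve⟩ := hbf.exists_extend_eq_mapDomain hst.1 hw
    (f := fun j => if j ≤ gapsBelow W y then j else j - 1) (by
      intro j
      split_ifs <;> omega)
  refine ⟨v, hv, ?_⟩
  have hyW : y ∉ W.erase M := fun h => hy (Finset.mem_of_mem_erase h)
  rw [hve, he', unshift, unshift, Finset.sum_insert hyW, Finsupp.mapDomain_add,
    Finsupp.mapDomain_finsetSum, add_comm]
  congr 1
  · rw [Finsupp.mapDomain_single, if_pos le_rfl]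
    congr 1
    apply gapsBelow_congr
    intro l hl
    simp only [Finset.mem_insert, Finset.mem_erase]
    constructor
    · intro h
      exact Or.inr ⟨by omega, h⟩
    · rintro (h | h)
      · omega
      · exact h.2
  · refine Finset.sum_congr rfl fun m hm => ?_
    rw [Finsupp.mapDomain_single]
    congr 1
    have hmM : m < M := lt_of_le_of_ne (hM.2 (Finset.mem_of_mem_erase hm)) (Finset.ne_of_mem_erase hm)
    have hmy : m ≠ y := by
      rintro rfl
      exact hyW hm
    have h1 : gapsBelow (W.erase M) m = gapsBelow W m := by
      apply gapsBelow_congr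
      intro l hl
      have : l ≠ M := by omega
      simp [this]
    rw [h1]
    rcases lt_or_gt_of_ne hmy with hlt | hlt
    · rw [if_pos (gapsBelow_mono W hlt.le)]
      apply gapsBelow_congr
      intro l hl
      have h2 : l ≠ M := by omega
      have h3 : l ≠ y := by omega
      simp [h2, h3]
    · have h2 := gapsBelow_lt hlt hy
      rw [if_neg (by omega)]
      have h3 : Finset.range m \ insert y (W.erase M) = (Finset.range m \ W).erase y := by
        ext l
        simp only [Finset.mem_sdiff, Finset.mem_range, Finset.mem_insert, Finset.mem_erase]
        constructor
        · rintro ⟨h4, h5⟩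
          push Not at h5
          refine ⟨h5.1, h4, fun h6 => h5.2 (by omega) h6⟩
        · rintro ⟨h4, h5, h6⟩
          exact ⟨h5, by tauto⟩
      rw [gapsBelow, gapsBelow, h3, Finset.card_erase_of_mem]
      simp [hlt, hy]

/-- Passing from `W` to `V` only lowers gap counts and keeps equal ones equal, so it acts on the
variables of `u` by a function allowed in a Borel-fixed ideal. The elements of `V` outside `W`
contribute further factors. -/
theorem monMem_of_unshift_subset (hst : IsStable I) (hbf : IsBorelFixed I) {u v : Fin n →₀ ℕ}
    (hu : MonMem I u) {W V : Finset ℕ} (hW : extend u = unshift W) (hV : extend v = unshift V)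
    (hWV : W ⊆ V) : MonMem I v := by
  classical
  have hwell : ∀ k ∈ W, ∀ l ∈ W, gapsBelow W k = gapsBelow W l → gapsBelow V k = gapsBelow V l := by
    intro k _ l _ h
    rcases le_total k l with hkl | hkl
    · exact gapsBelow_eq_of_subset hWV hkl h
    · exact (gapsBelow_eq_of_subset hWV hkl h.symm).symm
  -- The chosen representative is immaterial by `hwell`; indices that are not gap counts of `W` are
  -- fixed merely to keep `f j ≤ j`.
  obtain ⟨w, hw, hwe⟩ := hbf.exists_extend_eq_mapDomain hst.1 hu
    (f := fun j => if h : ∃ k ∈ W, gapsBelow W k = j then gapsBelow V h.choose else j) (by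
      intro j
      split_ifs with h
      · refine (gapsBelow_anti hWV _).trans ?_
        rw [h.choose_spec.2]
      · exact le_rfl)
  refine MonMem.mono hw (le_of_extend_le ?_)
  rw [hwe, hW, hV, unshift, unshift, Finsupp.mapDomain_finsetSum]
  refine le_trans (le_of_eq ?_) (Finset.sum_le_sum_of_subset hWV)
  refine Finset.sum_congr rfl fun k hk => ?_
  have h : ∃ l ∈ W, gapsBelow W l = gapsBelow W k := ⟨k, hk, rfl⟩
  rw [Finsupp.mapDomain_single, dif_pos h]
  congr 1
  exact hwell _ h.choose_spec.1 _ hk h.choose_spec.2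

/-- If the inclusion were proper, `v` without its last variable would lie in `I`, against
minimality. Let `M` be the maximum of `sigmaSet v`. Either `M` is missing from `sigmaSet u`, or it
can be exchanged there for an element `y` of the difference; in both cases the resulting set avoids
`M` and lies in `sigmaSet v`. -/
theorem eq_of_sigmaSet_subset (hst : IsStable I) (hbf : IsBorelFixed I) {u v : Fin n →₀ ℕ}
    (hu : u ∈ minGens I) (hv : v ∈ minGens I) (h : sigmaSet u ⊆ sigmaSet v) : u = v := by
  by_contra hne
  have hssub : sigmaSet u ⊂ sigmaSet v :=
    lt_of_le_of_ne h fun heq => hne (sigmaSet_injective heq)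
  obtain ⟨y, hyv, hyu⟩ := Finset.exists_of_ssubset hssub
  obtain ⟨M, hM⟩ : ∃ M, IsGreatest (sigmaSet v : Set ℕ) M :=
    ⟨_, (sigmaSet v).isGreatest_max' ⟨y, hyv⟩⟩
  obtain ⟨k, hk, -, he, -⟩ := exists_isMaxVar_unshift (unshift_sigmaSet v).symm hM
  have hmem : MonMem I (v - Finsupp.single k 1) := by
    by_cases hMu : M ∈ sigmaSet u
    · have hMu' : IsGreatest (sigmaSet u : Set ℕ) M := ⟨hMu, fun l hl => hM.2 (h hl)⟩
      have hyM : y ≠ M := by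
        rintro rfl
        exact hyu hMu
      obtain ⟨u', hu', hue⟩ := monMem_of_unshift_exchange hst hbf hu.1 (unshift_sigmaSet u).symm
        hMu' (lt_of_le_of_ne (hM.2 hyv) hyM) hyu
      refine monMem_of_unshift_subset hst hbf hu' hue he ?_
      refine Finset.insert_subset (Finset.mem_erase.2 ⟨hyM, hyv⟩) (Finset.erase_subset_erase _ h)
    · refine monMem_of_unshift_subset hst hbf hu.1 (unshift_sigmaSet u).symm he ?_
      exact Finset.subset_erase.2 ⟨h, hMu⟩
  have hle := hv.2 hmem tsub_le_self k
  rw [Finsupp.tsub_apply, Finsupp.single_eq_same] at hle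
  have := Finsupp.mem_support_iff.1 hk.1
  omega

variable {N : ℕ}

theorem sigmaMon_injOn (hN : ∀ u ∈ minGens I, ∀ s ∈ sigmaSet u, s < N) :
    Set.InjOn (sigmaMon N) (minGens I) := by
  intro u hu v hv h
  exact sigmaSet_injective (le_antisymm (sigmaSet_subset_of_sigmaMon_le (hN u hu) h.le)
    (sigmaSet_subset_of_sigmaMon_le (hN v hv) h.ge))

theorem minGens_sigmaIdeal (hst : IsStable I) (hbf : IsBorelFixed I)
    (hN : ∀ u ∈ minGens I, ∀ s ∈ sigmaSet u, s < N) :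
    minGens (sigmaIdeal N I) = sigmaMon N '' minGens I := by
  apply minGens_monomialSpan_of_antichain
  rintro _ ⟨u, hu, rfl⟩ _ ⟨v, hv, rfl⟩ h
  rw [eq_of_sigmaSet_subset hst hbf hu hv (sigmaSet_subset_of_sigmaMon_le (hN u hu) h)]

/-- Let `u^σ` divide `w`. If `x_k` does not divide `u^σ`, then `u^σ` still divides the exchanged
monomial. Otherwise `k` is also the maximum of `sigmaSet u`; the exchange is carried out there, and
`exists_minGens_subset` supplies a generator. -/
theorem isSqfreeStable_sigmaIdeal (hst : IsStable I) (hbf : IsBorelFixed I)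
    (hN : ∀ u ∈ minGens I, ∀ s ∈ sigmaSet u, s < N) : IsSqfreeStable (sigmaIdeal N I) := by
  refine ⟨⟨_, ?_, rfl⟩, ?_⟩
  · rintro _ ⟨u, _, rfl⟩
    exact sqfreeMon_sigmaMon N u
  intro w _ hwI k hk i hik hiw
  obtain ⟨_, ⟨u, hu, rfl⟩, huw⟩ := monMem_monomialSpan.1 hwI
  rw [sigmaMon_le_iff (hN u hu)] at huw
  have hsupp : ∀ l : Fin N, l ≠ k → l ∈ w.support → l ∈ (exchange w k i).support := by
    intro l hlk hl
    have hli : l ≠ i := by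
      rintro rfl
      exact hiw hl
    rw [Finsupp.mem_support_iff, exchange_apply_of_ne hlk hli]
    exact Finsupp.mem_support_iff.1 hl
  refine monMem_monomialSpan.2 ?_
  by_cases hku : (k : ℕ) ∈ sigmaSet u
  · have hM : IsGreatest (sigmaSet u : Set ℕ) k := ⟨hku, fun s hs => hk.2 (huw s hs)⟩
    obtain ⟨v, hv, hve⟩ := monMem_of_unshift_exchange hst hbf hu.1 (unshift_sigmaSet u).symm
      hM hik (fun hi => hiw (huw i hi))
    obtain ⟨x, hx, hxs⟩ := hst.exists_minGens_subset _ v hv hve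
    refine ⟨_, ⟨x, hx, rfl⟩, (sigmaMon_le_iff (hN x hx)).2 fun s hs => ?_⟩
    rcases Finset.mem_insert.1 (hxs hs) with rfl | hs'
    · rw [Finsupp.mem_support_iff, Fin.eta, exchange_apply_right hik.ne]
      omega
    · obtain ⟨hsk, hsu⟩ := Finset.mem_erase.1 hs'
      exact hsupp _ (fun h => hsk (congrArg Fin.val h)) (huw s hsu)
  · refine ⟨_, ⟨u, hu, rfl⟩, (sigmaMon_le_iff (hN u hu)).2 fun s hs => ?_⟩
    refine hsupp _ (fun h => hku ?_) (huw s hs)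
    rwa [← h]

/-- For `u` one counts the variables before the last one, for `u^σ` the gaps below its largest index
`M`; both numbers are `gapsBelow (sigmaSet u) M`. -/
theorem card_exchangeVars_sigmaMon {u : Fin n →₀ ℕ} (hu : ∀ s ∈ sigmaSet u, s < N) :
    (exchangeVars 1 (sigmaMon N u)).card = (exchangeVars ⊤ u).card := by
  classical
  rcases (sigmaSet u).eq_empty_or_nonempty with h0 | hne
  · have h1 : u = 0 := by
      apply extend_injective
      rw [← unshift_sigmaSet, h0]
      simp [unshift, extend]
    have h2 : ∀ i, i ∉ exchangeVars 1 (sigmaMon N u) := by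
      intro i hi
      obtain ⟨-, k, hk, -⟩ := mem_exchangeVars.1 hi
      rw [mem_support_sigmaMon, h0] at hk
      simp at hk
    have h3 : ∀ i, i ∉ exchangeVars ⊤ u := by
      intro i hi
      obtain ⟨-, k, hk, -⟩ := mem_exchangeVars.1 hi
      simp [h1] at hk
    rw [Finset.eq_empty_of_forall_notMem h2, Finset.eq_empty_of_forall_notMem h3]
    rfl
  obtain ⟨M, hM⟩ : ∃ M, IsGreatest (sigmaSet u : Set ℕ) M :=
    ⟨_, (sigmaSet u).isGreatest_max' hne⟩
  obtain ⟨k, hk, hkM, -, -⟩ := exists_isMaxVar_unshift (unshift_sigmaSet u).symm hM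
  have h1 : exchangeVars ⊤ u = Finset.Iio k := by
    ext i
    rw [mem_exchangeVars, Finset.mem_Iio]
    exact ⟨fun ⟨_, l, hl, hil⟩ => lt_of_lt_of_le hil (hk.2 hl),
      fun h => ⟨ENat.natCast_lt_top _, k, hk.1, h⟩⟩
  rw [h1, Fin.card_Iio, hkM, gapsBelow, ← Finset.card_map Fin.valEmbedding]
  congr 1
  ext s
  simp only [Finset.mem_map, mem_exchangeVars, Fin.valEmbedding_apply, Finset.mem_sdiff,
    Finset.mem_range]
  constructor
  · rintro ⟨i, ⟨hi, l, hl, hil⟩, rfl⟩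
    rw [mem_support_sigmaMon] at hl
    refine ⟨lt_of_lt_of_le hil (hM.2 hl), fun h => ?_⟩
    rw [sigmaMon_apply, if_pos h] at hi
    simp at hi
  · rintro ⟨hs, hsu⟩
    have hMN := hu M hM.1
    refine ⟨⟨s, hs.trans hMN⟩, ⟨?_, ⟨M, hMN⟩, mem_support_sigmaMon.2 hM.1, hs⟩, rfl⟩
    rw [sigmaMon_apply, if_neg hsu]
    simp

end Shift

/-! ### Stable and squarefree stable ideals as bounded stable ideals, and the main theorem -/

theorem IsStable.isBoundedStable {K : Type*} [Field K] {n : ℕ}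
    {I : Ideal (MvPolynomial (Fin n) K)} (h : IsStable I) : IsBoundedStable ⊤ I :=
  fun u _ hu k hk i hik _ => h.2 u hu k hk i hik

theorem exponentsLE_one_iff {n : ℕ} {u : Fin n →₀ ℕ} : ExponentsLE 1 u ↔ SqfreeMon u :=
  forall_congr' fun _ => by norm_cast

theorem IsSqfreeStable.isBoundedStable {K : Type*} [Field K] {n : ℕ}
    {I : Ideal (MvPolynomial (Fin n) K)} (h : IsSqfreeStable I) : IsBoundedStable 1 I := by
  intro u hu huI k hk i hik he
  refine h.2 u (exponentsLE_one_iff.1 hu) huI k hk i hik fun hi => ?_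
  have h1 := exponentsLE_one_iff.1 he i
  rw [exchange_apply_right hik.ne] at h1
  have := Finsupp.mem_support_iff.1 hi
  omega

end

end SqfreeShift

/-- The bound `hN` says that `m(u) + deg u - 1 ≤ N` for all `u ∈ G(I)`, that is, `I^σ` is an ideal
of `K[x_1, …, x_N]`. Equality of the graded Betti numbers is stated as: both ideals have minimal
graded free resolutions, and any two of them have the same numbers of summands `S(-j)` in each
homological degree `i`. -/
theorem mainTheorem7 {K : Type*} [Field K] [Infinite K] {n : ℕ}
    (I : Ideal (MvPolynomial (Fin n) K))
    (hst : SqfreeShift.IsStable I) (hbf : SqfreeShift.IsBorelFixed I)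
    (N : ℕ) (hN : ∀ u ∈ SqfreeShift.minGens I, SqfreeShift.maxVar u + u.degree ≤ N + 1) :
    SqfreeShift.IsSqfreeStable (SqfreeShift.sigmaIdeal N I) ∧
    SqfreeShift.minGens (SqfreeShift.sigmaIdeal N I) =
      SqfreeShift.sigmaMon N '' SqfreeShift.minGens I ∧
    Nonempty (SqfreeShift.MinGradedFreeResolution I) ∧
    Nonempty (SqfreeShift.MinGradedFreeResolution (SqfreeShift.sigmaIdeal N I)) ∧
    ∀ (F : SqfreeShift.MinGradedFreeResolution I)
      (G : SqfreeShift.MinGradedFreeResolution (SqfreeShift.sigmaIdeal N I)) (i : ℕ) (j : ℤ),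
      F.betti i j = G.betti i j := by
  classical
  have hN' : ∀ u ∈ SqfreeShift.minGens I, ∀ s ∈ SqfreeShift.sigmaSet u, s < N :=
    fun u hu s hs => SqfreeShift.lt_of_mem_sigmaSet (hN u hu) hs
  have hsq := SqfreeShift.isSqfreeStable_sigmaIdeal hst hbf hN'
  have hG := SqfreeShift.minGens_sigmaIdeal hst hbf hN'
  obtain ⟨F₀, hF₀⟩ := hst.isBoundedStable.exists_resolution hst.1 fun _ _ _ => le_top
  obtain ⟨G₀, hG₀⟩ := hsq.isBoundedStable.exists_resolution ⟨_, rfl⟩ (by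
    rw [hG]
    rintro _ ⟨u, _, rfl⟩
    exact SqfreeShift.exponentsLE_one_iff.2 (SqfreeShift.sqfreeMon_sigmaMon N u))
  refine ⟨hsq, hG, ⟨F₀⟩, ⟨G₀⟩, fun F G i j => ?_⟩
  rw [F.betti_eq F₀, G.betti_eq G₀, hF₀, hG₀]
  have himg : (SqfreeShift.minGens_finite (SqfreeShift.sigmaIdeal N I)).toFinset =
      (SqfreeShift.minGens_finite I).toFinset.image (SqfreeShift.sigmaMon N) := by
    ext w
    simp [hG]
  rw [himg, Finset.sum_image (by
    intro u hu v hv h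
    exact SqfreeShift.sigmaMon_injOn hN' (by simpa using hu) (by simpa using hv) h)]
  refine Finset.sum_congr rfl fun u hu => ?_
  have hu' := hN' u (by simpa using hu)
  rw [SqfreeShift.degree_sigmaMon hu', SqfreeShift.card_exchangeVars_sigmaMon hu']
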